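/- Let $k\in\mathbb{N}$ and let $G$ be a finite simple graph that is $50k$-connected, that is, $G$ has more than $50k$ vertices and $G-X$ is connected for every set $X$ of fewer than $50k$ vertices. Then at least one of the following statements holds. (1) $G$ contains $k$ pairwise vertex-disjoint odd cycles. (2) There is a set $X$ of exactly $2k-2$ vertices of $G$ such that $G-X$ is bipartite. -/

import Mathlib

namespace OddCyclePacking

/-- A finite graph `G` is `n`-connected if it has more than `n` vertices and `G - X` is connected
for every set `X` of fewer than `n` vertices. -/
def IsVertexConnected {V : Type*} [Fintype V] (G : SimpleGraph V) (n : ℕ) : Prop :=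
  n < Fintype.card V ∧
    ∀ X : Finset V, X.card < n → (G.induce ((X : Set V)ᶜ)).Connected

/-- `G` contains `k` odd cycles that are pairwise vertex-disjoint. -/
def HasDisjointOddCycles {V : Type*} (G : SimpleGraph V) (k : ℕ) : Prop :=
  ∃ (v : Fin k → V) (c : ∀ i, G.Walk (v i) (v i)),
    (∀ i, (c i).IsCycle ∧ Odd (c i).length) ∧
    ∀ i j, i ≠ j → List.Disjoint (c i).support (c j).support

end OddCyclePacking

/-! Some bipartition cuts at least half of the edges, so the cut graph still has average degree at
least 25k. It therefore contains a set U of at least 10k vertices in which any k disjoint pairs can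
be linked inside U (`exists_isLinkedSet`). A walk of G between two vertices of U whose parity
disagrees with the sides of its ends is closed up by such a link to an odd closed walk, so k
disjoint parity-breaking connections between vertices of U give k disjoint odd cycles.

These connections are found by matching theory. In `doubleGraph`, exchanging the two copies of a
vertex is a matching `swap` that misses exactly the |U| copies of vertices of U. If another matching
misses at most |U| - 2k vertices, the union of the two has k components that are paths between
copies of vertices of U, and these are the required connections
(`hasDisjointOddCycles_of_involution`).

If there is no such matching, the Tutte–Berge formula gives a set S whose deletion leaves at least
|S| + |U| - 2k + 2 odd parts. Deleting the vertices with all copies in S, and all but one lone copy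
for each part, costs at most 2k - 2 vertices of G (`exists_deletion`). By connectivity every
remaining vertex has exactly one copy outside S, and the index of that copy is a proper 2-colouring
(`isBipartite_of_labels`).

The linked set comes from density: a minimal induced subgraph of large average degree has no
separation of small order and has a very dense minor. No 2k roots can be cut off from that minor by
fewer than 2k vertices, so they can be linked through it (`IsRooted.linked`). -/

namespace OddCyclePacking

universe u

/-! ### Reachability inside a vertex set. -/

section Reach

variable {V W : Type*} {G H : SimpleGraph V} {S T : Set V} {a b c : V}

/-- `b` can be reached from `a` along edges of `G` with both ends in `S`. -/
def ReachIn (G : SimpleGraph V) (S : Set V) : V → V → Prop :=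
  Relation.ReflTransGen fun a b => G.Adj a b ∧ a ∈ S ∧ b ∈ S

theorem ReachIn.refl : ReachIn G S a a := Relation.ReflTransGen.refl

theorem ReachIn.of_adj (h : G.Adj a b) (ha : a ∈ S) (hb : b ∈ S) : ReachIn G S a b :=
  Relation.ReflTransGen.single ⟨h, ha, hb⟩

theorem ReachIn.trans (h : ReachIn G S a b) (h' : ReachIn G S b c) : ReachIn G S a c :=
  Relation.ReflTransGen.trans h h'

theorem ReachIn.symm (h : ReachIn G S a b) : ReachIn G S b a := by
  induction h with
  | refl => exact .refl
  | tail _ h ih => exact (ReachIn.of_adj h.1.symm h.2.2 h.2.1).trans ih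

theorem ReachIn.map {K : SimpleGraph W} {R : Set W} {f : V → W}
    (hf : ∀ a b, G.Adj a b → a ∈ S → b ∈ S → ReachIn K R (f a) (f b))
    (h : ReachIn G S a b) : ReachIn K R (f a) (f b) := by
  induction h with
  | refl => exact .refl
  | tail _ h ih => exact ih.trans (hf _ _ h.1 h.2.1 h.2.2)

theorem ReachIn.mono (hST : S ⊆ T) (h : ReachIn G S a b) : ReachIn G T a b :=
  h.map (f := id) fun _ _ hab ha hb => .of_adj hab (hST ha) (hST hb)

theorem ReachIn.mono_graph (hGH : G ≤ H) (h : ReachIn G S a b) : ReachIn H S a b :=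
  h.map (f := id) fun _ _ hab ha hb => .of_adj (hGH hab) ha hb

theorem ReachIn.mem (h : ReachIn G S a b) (ha : a ∈ S) : b ∈ S := by
  induction h with
  | refl => exact ha
  | tail _ h _ => exact h.2.2

theorem ReachIn.eq_of_forall_not_adj (h : ReachIn G S a b)
    (hS : ∀ c ∈ S, a ∈ S → ¬ G.Adj a c) : a = b := by
  induction h using Relation.ReflTransGen.head_induction_on with
  | refl => rfl
  | head h _ _ => exact absurd h.1 (hS _ h.2.2 h.2.1)

/-- A set closed under adjacency inside `S` contains everything that is reached from it. -/
theorem ReachIn.closed (hT : ∀ a b, G.Adj a b → a ∈ S → b ∈ S → a ∈ T → b ∈ T)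
    (h : ReachIn G S a b) (ha : a ∈ T) : b ∈ T ∧ ReachIn G (S ∩ T) a b := by
  induction h with
  | refl => exact ⟨ha, .refl⟩
  | tail _ h ih =>
    have := hT _ _ h.1 h.2.1 h.2.2 ih.1
    exact ⟨this, ih.2.trans (.of_adj h.1 ⟨h.2.1, ih.1⟩ ⟨h.2.2, this⟩)⟩

/-- The first vertex of a target set `T` on a path inside `S`. -/
theorem ReachIn.first_hit (h : ReachIn G S a b) (ha : a ∈ S) (hb : b ∈ T) :
    a ∈ T ∨ ∃ y z, a ∉ T ∧ y ∈ S \ T ∧ ReachIn G (S \ T) a y ∧ G.Adj y z ∧ z ∈ S ∧ z ∈ T := by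
  by_contra! hc
  obtain ⟨haT, hc⟩ := hc
  have : b ∈ S \ T ∧ ReachIn G (S \ T) a b := by
    clear hb
    induction h with
    | refl => exact ⟨⟨ha, haT⟩, .refl⟩
    | tail _ h ih =>
      have hz := hc _ _ haT ih.1 ih.2 h.1 h.2.2
      exact ⟨⟨h.2.2, hz⟩, ih.2.trans (.of_adj h.1 ih.1 ⟨h.2.2, hz⟩)⟩
  exact this.1.2 hb

theorem ReachIn.of_induce {A : Set V} {R : Set A} {x y : A}
    (h : ReachIn (G.induce A) R x y) : ReachIn G (Subtype.val '' R) x.1 y.1 :=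
  h.map fun _ _ hab ha hb => .of_adj hab ⟨_, ha, rfl⟩ ⟨_, hb, rfl⟩

theorem ReachIn.to_induce {A : Set V} (h : ReachIn G S a b) (hS : S ⊆ A) (ha : a ∈ A) :
    ∃ hb : b ∈ A, ReachIn (G.induce A) (Subtype.val ⁻¹' S) ⟨a, ha⟩ ⟨b, hb⟩ := by
  induction h with
  | refl => exact ⟨ha, .refl⟩
  | tail _ h ih =>
    obtain ⟨hb, ih⟩ := ih
    exact ⟨hS h.2.2, ih.trans (.of_adj h.1 h.2.1 h.2.2)⟩

end Reach

/-! ### Minor models and edge contraction. -/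

section Minor

variable {V V' W : Type*}

/-- `f` is a model of `M` as a minor of `G`: the fibers of `f` are the branch sets. -/
structure IsModel (G : SimpleGraph V) (M : SimpleGraph W) (f : V → Option W) : Prop where
  nonempty : ∀ w, ∃ v, f v = some w
  conn : ∀ w v v', f v = some w → f v' = some w → ReachIn G {z | f z = some w} v v'
  adj : ∀ w w', M.Adj w w' → ∃ v v', f v = some w ∧ f v' = some w' ∧ G.Adj v v'

theorem IsModel.trans {G : SimpleGraph V} {G' : SimpleGraph V'} {M : SimpleGraph W}
    {f : V → Option V'} {g : V' → Option W} (hf : IsModel G G' f) (hg : IsModel G' M g) :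
    IsModel G M fun v => (f v).bind g where
  nonempty w := by
    obtain ⟨a, ha⟩ := hg.nonempty w
    obtain ⟨v, hv⟩ := hf.nonempty a
    exact ⟨v, by simp [hv, ha]⟩
  conn w v v' hv hv' := by
    obtain ⟨a, hva, haw⟩ := Option.bind_eq_some_iff.1 hv
    obtain ⟨a', hva', haw'⟩ := Option.bind_eq_some_iff.1 hv'
    have fib : ∀ c, g c = some w → ∀ p q, f p = some c → f q = some c →
        ReachIn G {z | (f z).bind g = some w} p q := fun c hc p q hp hq =>
      (hf.conn c p q hp hq).mono fun z hz => by
        have hz : f z = some c := hz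
        simp [hz, hc]
    have key := hg.conn w a a' haw haw'
    clear hv
    induction key using Relation.ReflTransGen.head_induction_on generalizing v with
    | refl => exact fib a' haw' v v' hva hva'
    | head h _ ih =>
      obtain ⟨p, q, hp, hq, hpq⟩ := hf.adj _ _ h.1
      refine (fib _ haw v p hva hp).trans (.trans (.of_adj hpq ?_ ?_) (ih q hq h.2.2))
      · simpa [hp] using haw
      · simpa [hq] using h.2.2
  adj w w' h := by
    obtain ⟨a, a', ha, ha', haa⟩ := hg.adj _ _ h
    obtain ⟨v, v', hv, hv', hvv⟩ := hf.adj _ _ haa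
    exact ⟨v, v', by simp [hv, ha], by simp [hv', ha'], hvv⟩

theorem isModel_of_le {G H : SimpleGraph V} (h : G ≤ H) : IsModel H G some where
  nonempty w := ⟨w, rfl⟩
  conn w v v' hv hv' := by
    cases hv; cases hv'; exact .refl
  adj w w' h' := ⟨w, w', rfl, rfl, h h'⟩

open Classical in
theorem isModel_induce (G : SimpleGraph V) (A : Set V) :
    IsModel G (G.induce A) fun v => if h : v ∈ A then some ⟨v, h⟩ else none where
  nonempty w := ⟨w, by simp⟩
  conn w v v' hv hv' := by
    have : v = v' := by
      split_ifs at hv hv'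
      simp_all only [Option.some.injEq]
      rw [← hv'] at hv; simpa using hv
    rw [this]; exact .refl
  adj w w' h := ⟨w, w', by simp, by simp, h⟩

theorem isModel_map (G : SimpleGraph V) {π : V → W} (hsurj : Function.Surjective π)
    (hconn : ∀ a b, π a = π b → ReachIn G (π ⁻¹' {π a}) a b) :
    IsModel G (G.map π) (some ∘ π) where
  nonempty w := by
    obtain ⟨v, rfl⟩ := hsurj w
    exact ⟨v, rfl⟩
  conn w v v' hv hv' := by
    simp only [Function.comp_apply, Option.some.injEq] at hv hv'
    subst hv
    simpa [Set.preimage] using hconn v v' hv'.symm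
  adj w w' h := by
    obtain ⟨-, v, v', h, rfl, rfl⟩ := h
    exact ⟨v, v', rfl, rfl, h⟩

open Classical in
/-- The map identifying `v` with `u`. -/
noncomputable def merge {u v : V} (huv : u ≠ v) (z : V) : {z // z ≠ v} :=
  if h : z = v then ⟨u, huv⟩ else ⟨z, h⟩

variable {u v : V} (huv : u ≠ v)

theorem merge_self : merge huv v = ⟨u, huv⟩ := by simp [merge]

theorem merge_of_ne {z : V} (hz : z ≠ v) : merge huv z = ⟨z, hz⟩ := by simp [merge, hz]

theorem merge_surjective : Function.Surjective (merge huv) := fun z => ⟨z, merge_of_ne huv z.2⟩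

theorem merge_eq_merge {a b : V} (h : merge huv a = merge huv b) :
    a = b ∨ (a = u ∧ b = v) ∨ (a = v ∧ b = u) := by
  by_cases ha : a = v <;> by_cases hb : b = v
  · simp [ha, hb]
  · subst ha; rw [merge_self, merge_of_ne _ hb] at h; simp_all
  · subst hb; rw [merge_self, merge_of_ne _ ha] at h; simp_all
  · rw [merge_of_ne _ ha, merge_of_ne _ hb] at h; simp_all

theorem merge_conn {G : SimpleGraph V} (hG : G.Adj u v) {a b : V}
    (h : merge huv a = merge huv b) : ReachIn G (merge huv ⁻¹' {merge huv a}) a b := by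
  rcases merge_eq_merge huv h with rfl | ⟨rfl, rfl⟩ | ⟨rfl, rfl⟩
  · exact .refl
  · exact .of_adj hG rfl h.symm
  · exact .of_adj hG.symm rfl h.symm

end Minor

/-! ### Counting ordered adjacent pairs (twice the number of edges). -/

section Count

variable {V : Type*} [Fintype V]

open Classical in
/-- The neighbours of `v` as a finset. -/
noncomputable def nbr (G : SimpleGraph V) (v : V) : Finset V := {w | G.Adj v w}

@[simp] theorem mem_nbr {G : SimpleGraph V} {v w : V} : w ∈ nbr G v ↔ G.Adj v w := by simp [nbr]

open Classical in
/-- The ordered pairs of adjacent vertices. -/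
noncomputable def adjPairs (G : SimpleGraph V) : Finset (V × V) := {p | G.Adj p.1 p.2}

@[simp] theorem mem_adjPairs {G : SimpleGraph V} {p : V × V} :
    p ∈ adjPairs G ↔ G.Adj p.1 p.2 := by simp [adjPairs]

theorem card_adjPairs (G : SimpleGraph V) : (adjPairs G).card = ∑ v, (nbr G v).card := by
  classical
  rw [← Finset.card_sigma]
  refine Finset.card_bij' (fun p _ => ⟨p.1, p.2⟩) (fun q _ => (q.1, q.2)) ?_ ?_ ?_ ?_ <;> simp

theorem card_adjPairs_induce (G : SimpleGraph V) (A : Set V) [Fintype A] [DecidablePred (· ∈ A)] :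
    (adjPairs (G.induce A)).card = ((adjPairs G).filter fun p => p.1 ∈ A ∧ p.2 ∈ A).card := by
  classical
  refine Finset.card_bij (fun p _ => (p.1.1, p.2.1)) ?_ ?_ ?_
  · rintro ⟨⟨a, ha⟩, ⟨b, hb⟩⟩ h
    simp_all
  · rintro ⟨⟨a, ha⟩, ⟨b, hb⟩⟩ h ⟨⟨c, hc⟩, ⟨d, hd⟩⟩ h'
    simp_all
  · rintro ⟨a, b⟩ h
    simp only [Finset.mem_filter, mem_adjPairs] at h
    exact ⟨(⟨a, h.2.1⟩, ⟨b, h.2.2⟩), by simpa using h.1, rfl⟩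

theorem card_nbr_induce (G : SimpleGraph V) (A : Set V) [Fintype A] [DecidablePred (· ∈ A)]
    (v : A) : (nbr (G.induce A) v).card = ((nbr G v).filter (· ∈ A)).card := by
  classical
  refine Finset.card_bij (fun p _ => p.1) ?_ ?_ ?_
  · rintro ⟨a, ha⟩ h
    simp_all
  · rintro ⟨a, ha⟩ h ⟨b, hb⟩ h'
    simp_all
  · rintro a h
    simp only [Finset.mem_filter, mem_nbr] at h
    exact ⟨⟨a, h.2⟩, by simpa using h.1, rfl⟩

theorem card_adjPairs_le_delete (G : SimpleGraph V) (v : V) [Fintype {z : V | z ≠ v}] :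
    (adjPairs G).card ≤ (adjPairs (G.induce {z | z ≠ v})).card + 2 * (nbr G v).card := by
  classical
  rw [card_adjPairs_induce]
  have : adjPairs G ⊆ ((adjPairs G).filter fun p => p.1 ∈ {z | z ≠ v} ∧ p.2 ∈ {z | z ≠ v}) ∪
      ((nbr G v).image (fun w => (v, w)) ∪ (nbr G v).image (fun w => (w, v))) := by
    rintro ⟨a, b⟩ h
    simp only [mem_adjPairs] at h
    by_cases ha : a = v
    · subst ha; simp [h]
    · by_cases hb : b = v
      · subst hb; simp [h.symm]
      · simp [h, ha, hb]
  refine (Finset.card_le_card this).trans ((Finset.card_union_le _ _).trans ?_)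
  have h1 := Finset.card_union_le ((nbr G v).image (fun w => (v, w)))
    ((nbr G v).image (fun w => (w, v)))
  have h2 := Finset.card_image_le (s := nbr G v) (f := fun w => (v, w))
  have h3 := Finset.card_image_le (s := nbr G v) (f := fun w => (w, v))
  omega

open Classical in
-- Only the edge itself is lost and, for each common neighbour, one of two edges that become
-- parallel. `L` contains the lost pairs, and the projection is injective off `L`.
theorem card_adjPairs_le_contract (G : SimpleGraph V) {u v : V} (huv : u ≠ v)
    [Fintype {z // z ≠ v}] :
    (adjPairs G).card ≤
      (adjPairs (G.map (merge huv))).card + 2 * (1 + (nbr G u ∩ nbr G v).card) := by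
  set C := nbr G u ∩ nbr G v with hC
  set L : Finset (V × V) := {(u, v), (v, u)} ∪ (C.image (fun w => (v, w)) ∪
    C.image (fun w => (w, v))) with hL
  have hLc : L.card ≤ 2 * (1 + C.card) := by
    have h0 : L.card ≤ _ := Finset.card_union_le _ _
    have h1 := Finset.card_union_le (C.image (fun w => (v, w))) (C.image (fun w => (w, v)))
    have h2 := Finset.card_image_le (s := C) (f := fun w => (v, w))
    have h3 := Finset.card_image_le (s := C) (f := fun w => (w, v))
    have h4 : ({(u, v), (v, u)} : Finset (V × V)).card ≤ 2 := Finset.card_le_two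
    omega
  have hmem : ∀ a b, (a, b) ∈ adjPairs G \ L → G.Adj a b ∧ ¬ (a = u ∧ b = v) ∧
      ¬ (a = v ∧ b = u) ∧ (a = v → ¬ G.Adj u b) ∧ (b = v → ¬ G.Adj u a) := by
    intro a b h
    simp only [hL, hC, Finset.mem_sdiff, mem_adjPairs, Finset.mem_union, Finset.mem_insert,
      Prod.mk.injEq, Finset.mem_singleton, Finset.mem_image, Finset.mem_inter, mem_nbr,
      not_or] at h
    refine ⟨h.1, h.2.1.1, h.2.1.2, ?_, ?_⟩
    · rintro rfl hub
      exact h.2.2.1 ⟨b, ⟨hub, h.1⟩, rfl, rfl⟩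
    · rintro rfl hub
      exact h.2.2.2 ⟨a, ⟨hub, h.1.symm⟩, rfl, rfl⟩
  have hinj : (adjPairs G \ L).card ≤ (adjPairs (G.map (merge huv))).card := by
    refine Finset.card_le_card_of_injOn (fun p => (merge huv p.1, merge huv p.2)) ?_ ?_
    · rintro ⟨a, b⟩ h
      obtain ⟨hab, h1, h2, -, -⟩ := hmem a b h
      simp only [Finset.mem_coe, mem_adjPairs]
      refine ⟨fun he => ?_, a, b, hab, rfl, rfl⟩
      rcases merge_eq_merge huv he with h | h | h
      · exact hab.ne h
      · exact h1 h
      · exact h2 h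
    · rintro ⟨a, b⟩ h ⟨c, d⟩ h' he
      obtain ⟨hab, h1, h2, h3, h4⟩ := hmem a b h
      obtain ⟨hcd, h1', h2', h3', h4'⟩ := hmem c d h'
      simp only [Prod.mk.injEq] at he
      have e1 := merge_eq_merge huv he.1
      have e2 := merge_eq_merge huv he.2
      have n1 := hab.ne
      have n2 := hcd.ne
      have s1 := hab.symm
      have s2 := hcd.symm
      clear he hmem hLc
      clear_value L C
      grind
  have := Finset.card_sdiff_add_card (s := adjPairs G) (t := L)
  have h5 : (adjPairs G).card ≤ (adjPairs G ∪ L).card :=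
    Finset.card_le_card Finset.subset_union_left
  omega

end Count

/-! ### Large average degree forces a dense minor. -/

section DenseMinor

/-- Every vertex is adjacent to a little more than half of the vertices. -/
def IsDense {W : Type*} [Fintype W] (k : ℕ) (M : SimpleGraph W) : Prop :=
  ∀ w, Fintype.card W + 4 * k ≤ 2 * (nbr M w).card + 2

/-- `G` has a dense nonempty minor. -/
def HasDenseMinor {V : Type u} (k : ℕ) (G : SimpleGraph V) : Prop :=
  ∃ (W : Type u) (_ : Fintype W) (_ : Nonempty W) (M : SimpleGraph W) (f : V → Option W),
    IsModel G M f ∧ IsDense k M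

theorem HasDenseMinor.of_isModel {V V' : Type u} {k : ℕ} {G : SimpleGraph V}
    {G' : SimpleGraph V'} {f : V → Option V'} (hf : IsModel G G' f) (h : HasDenseMinor k G') :
    HasDenseMinor k G := by
  obtain ⟨W, i1, i2, M, g, hg, hM⟩ := h
  exact ⟨W, i1, i2, M, _, hf.trans hg, hM⟩

variable {V : Type u} [Fintype V]

theorem card_nbr_lt (G : SimpleGraph V) (v : V) : (nbr G v).card < Fintype.card V :=
  Finset.card_lt_univ_of_notMem (x := v) (by simp)

theorem card_adjPairs_le_mul (G : SimpleGraph V) :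
    (adjPairs G).card ≤ Fintype.card V * (Fintype.card V - 1) := by
  rw [card_adjPairs, ← smul_eq_mul, ← Finset.card_univ]
  refine Finset.sum_le_card_nsmul _ _ _ fun v _ => ?_
  have := card_nbr_lt G v
  rw [Finset.card_univ]; omega

theorem card_setOf_ne (v : V) [Fintype {z : V | z ≠ v}] :
    Fintype.card {z : V | z ≠ v} + 1 = Fintype.card V := by
  classical
  have := Set.card_ne_eq v
  have hpos : 0 < Fintype.card V := Fintype.card_pos_iff.2 ⟨v⟩
  have h2 : Fintype.card {z : V | z ≠ v} = Fintype.card V - 1 := by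
    rw [← this]
  omega

open Classical in
theorem card_nbr_induce_nbr (G : SimpleGraph V) (v : V) (u : {z | G.Adj v z}) :
    (nbr (G.induce {z | G.Adj v z}) u).card = (nbr G u.1 ∩ nbr G v).card := by
  rw [card_nbr_induce]
  congr 1
  ext z
  simp

theorem card_setOf_adj (G : SimpleGraph V) (v : V) [Fintype {z | G.Adj v z}] :
    Fintype.card {z | G.Adj v z} = (nbr G v).card := by
  rw [← Set.toFinset_card]
  congr 1
  ext z
  simp

/-- A vertex of degree at most 4k can be deleted. If a vertex v violates density in a graph on N
vertices, and u violates it in the neighbourhood of v, then u and v have fewer than N/4 + 3k - 1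
common neighbours. Contracting uv then costs less in `4 * (adjPairs G).card` than 2N + 24k, the drop
of the quadratic bound. -/
theorem hasDenseMinor_of_quadratic {k : ℕ} (n : ℕ) : ∀ (V : Type u) [Fintype V]
    (G : SimpleGraph V), Fintype.card V = n → 0 < n →
    n * (n + 1 + 24 * k) ≤ 4 * (adjPairs G).card → HasDenseMinor k G := by
  classical
  induction n with
  | zero => intro V _ G _ h; omega
  | succ n ih =>
    intro V _ G hV _ hG
    have hne : Nonempty V := Fintype.card_pos_iff.1 (by omega)
    by_cases hd : IsDense k G
    · exact ⟨V, _, hne, G, some, isModel_of_le le_rfl, hd⟩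
    simp only [IsDense, not_forall, not_le] at hd
    obtain ⟨v, hv⟩ := hd
    have hn : 8 * k + 1 ≤ n := by
      have h := card_adjPairs_le_mul G
      rw [hV] at h
      have h2 : (n + 1) * (n + 1 + 1 + 24 * k) ≤ (n + 1) * (4 * n) := by
        calc _ ≤ _ := hG
          _ ≤ 4 * ((n + 1) * n) := by simpa using h
          _ = _ := by ring
      have := Nat.le_of_mul_le_mul_left h2 (by omega)
      omega
    rw [hV] at hv
    by_cases hsmall : (nbr G v).card ≤ 4 * k
    · have hle := card_adjPairs_le_delete G v
      have hc := card_setOf_ne v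
      refine HasDenseMinor.of_isModel (isModel_induce G {z | z ≠ v})
        (ih _ _ (by omega) (by omega) ?_)
      nlinarith
    have hpos : 0 < (nbr G v).card := by omega
    obtain ⟨z0, hz0⟩ := Finset.card_pos.1 hpos
    by_cases hd' : IsDense k (G.induce {z | G.Adj v z})
    · exact HasDenseMinor.of_isModel (isModel_induce G {z | G.Adj v z})
        ⟨_, _, ⟨⟨z0, by simpa using hz0⟩⟩, _, some, isModel_of_le le_rfl, hd'⟩
    simp only [IsDense, not_forall, not_le] at hd'
    obtain ⟨u, hu⟩ := hd'
    rw [card_nbr_induce_nbr, card_setOf_adj] at hu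
    have huv : G.Adj u.1 v := SimpleGraph.Adj.symm u.2
    have hle := card_adjPairs_le_contract G huv.ne
    have hc : Fintype.card {z // z ≠ v} + 1 = Fintype.card V := card_setOf_ne v
    refine HasDenseMinor.of_isModel
      (isModel_map G (merge_surjective huv.ne) fun a b h => merge_conn huv.ne huv h)
        (ih _ _ (by omega) (by omega) ?_)
    nlinarith

theorem exists_delete_edge (G : SimpleGraph V) (h : 0 < (adjPairs G).card) :
    ∃ H ≤ G, (adjPairs H).card < (adjPairs G).card ∧
      (adjPairs G).card ≤ (adjPairs H).card + 2 := by
  classical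
  obtain ⟨⟨a, b⟩, hab⟩ := Finset.card_pos.1 h
  rw [mem_adjPairs] at hab
  refine ⟨G.deleteEdges {s(a, b)}, G.deleteEdges_le _, ?_, ?_⟩
  · refine Finset.card_lt_card ⟨fun p => by simp +contextual, fun h => ?_⟩
    have := @h (a, b) (by simpa using hab)
    simp at this
  · have : adjPairs G ⊆ adjPairs (G.deleteEdges {s(a, b)}) ∪ {(a, b), (b, a)} := by
      rintro ⟨c, d⟩ h
      simp only [mem_adjPairs] at h
      simp [h]
      tauto
    refine (Finset.card_le_card this).trans ((Finset.card_union_le _ _).trans ?_)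
    have := Finset.card_le_two (a := (a, b)) (b := (b, a))
    omega

/-- Surplus edges are deleted, and an edge with fewer than 12k common neighbours is contracted. If
neither is possible, averaging gives a vertex of degree below 24k; unless isolated, its
neighbourhood has minimum degree at least 12k, enough for the quadratic bound. The order cannot sink
to 10k, where the bound asks for more pairs than exist. -/
theorem hasDenseMinor_of_linear {k : ℕ} (hk : 0 < k) (n : ℕ) : ∀ (V : Type u) [Fintype V]
    (G : SimpleGraph V), Fintype.card V = n → 10 * k ≤ n →
    24 * k * n ≤ (adjPairs G).card + 48 * k * k → HasDenseMinor k G := by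
  classical
  induction n with
  | zero => intro V _ G _ h; omega
  | succ n ih =>
    intro V _ G hV hn hG
    have hn' : 10 * k ≤ n := by
      by_contra hlt
      have hn1 : n + 1 = 10 * k := by omega
      have h := card_adjPairs_le_mul G
      rw [hV, hn1] at h
      rw [hn1] at hG
      have : 10 * k * (10 * k - 1) ≤ 10 * k * (10 * k) := Nat.mul_le_mul_left _ (by omega)
      nlinarith
    generalize hm : (adjPairs G).card = m
    induction m using Nat.strong_induction_on generalizing G with
    | _ m ihm =>
    by_cases hsurplus : 24 * k * (n + 1) + 2 ≤ m + 48 * k * k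
    · have hpos : 0 < (adjPairs G).card := by
        rw [hm]; nlinarith
      obtain ⟨H, hH, hlt, hle⟩ := exists_delete_edge G hpos
      exact HasDenseMinor.of_isModel (isModel_of_le hH)
        (ihm _ (by omega) H (by omega) rfl)
    by_cases hc : ∃ u v, G.Adj u v ∧ (nbr G u ∩ nbr G v).card + 1 ≤ 12 * k
    · obtain ⟨u, v, huv, ht⟩ := hc
      have hle := card_adjPairs_le_contract G huv.ne
      have hc : Fintype.card {z // z ≠ v} + 1 = Fintype.card V := card_setOf_ne v
      refine HasDenseMinor.of_isModel
        (isModel_map G (merge_surjective huv.ne) fun a b h => merge_conn huv.ne huv h)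
          (ih _ _ (by omega) (by omega) ?_)
      nlinarith
    push Not at hc
    obtain ⟨v, hv⟩ : ∃ v, (nbr G v).card < 24 * k := by
      by_contra! hall
      have := Finset.card_nsmul_le_sum Finset.univ (fun v => (nbr G v).card) (24 * k)
        fun v _ => hall v
      rw [← card_adjPairs, Finset.card_univ, hV, smul_eq_mul, hm] at this
      nlinarith
    obtain h0 | hpos := Nat.eq_zero_or_pos (nbr G v).card
    · have hle := card_adjPairs_le_delete G v
      have hc := card_setOf_ne v
      refine HasDenseMinor.of_isModel (isModel_induce G {z | z ≠ v})
        (ih _ _ (by omega) (by omega) ?_)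
      nlinarith
    refine HasDenseMinor.of_isModel (isModel_induce G {z | G.Adj v z})
      (hasDenseMinor_of_quadratic (nbr G v).card _ _ (card_setOf_adj G v) hpos ?_)
    have h1 : (nbr G v).card * (12 * k) ≤ (adjPairs (G.induce {z | G.Adj v z})).card := by
      rw [card_adjPairs, ← card_setOf_adj G v, ← Finset.card_univ, ← smul_eq_mul]
      refine Finset.card_nsmul_le_sum _ _ _ fun u _ => ?_
      rw [card_nbr_induce_nbr]
      have := hc u.1 v (SimpleGraph.Adj.symm u.2)
      omega
    nlinarith

end DenseMinor

/-! ### Common neighbours in a dense graph. -/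

section DenseCommon

theorem IsDense.le_card {W : Type*} [Fintype W] {k : ℕ} {M : SimpleGraph W} [Nonempty W]
    (hM : IsDense k M) : 4 * k ≤ Fintype.card W := by
  obtain ⟨w⟩ := ‹Nonempty W›
  have h1 := hM w
  have h2 : (nbr M w).card < Fintype.card W := Finset.card_lt_univ_of_notMem (x := w) (by simp)
  omega

variable {W : Type*} [Fintype W] [DecidableEq W] {k : ℕ} {M : SimpleGraph W}

theorem IsDense.le_card_common (hM : IsDense k M) (w w' : W) :
    4 * k ≤ (nbr M w ∩ nbr M w').card + 2 := by
  have h1 := hM w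
  have h2 := hM w'
  have h3 := Finset.card_union_add_card_inter (nbr M w) (nbr M w')
  have h4 := Finset.card_le_univ (nbr M w ∪ nbr M w')
  omega

/-- Neither neighbourhood contains `w` or `w'`, which improves the general count by 2. -/
theorem IsDense.le_card_common_of_not_adj (hM : IsDense k M) {w w' : W} (hne : w ≠ w')
    (hadj : ¬ M.Adj w w') : 4 * k ≤ (nbr M w ∩ nbr M w').card := by
  have h1 := hM w
  have h2 := hM w'
  have h3 := Finset.card_union_add_card_inter (nbr M w) (nbr M w')
  have h4 : (nbr M w ∪ nbr M w' ∪ {w, w'}).card ≤ Fintype.card W := Finset.card_le_univ _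
  rw [Finset.card_union_of_disjoint, Finset.card_pair hne] at h4
  · omega
  · rw [Finset.disjoint_left]
    intro z hz hz'
    simp only [Finset.mem_union, mem_nbr, Finset.mem_insert, Finset.mem_singleton] at hz hz'
    have := fun h : M.Adj w' w => hadj h.symm
    rcases hz' with rfl | rfl <;> rcases hz with h | h <;> simp_all

end DenseCommon

/-! ### Menger's theorem. -/

section Menger

variable {V : Type*}

/-- `Z` meets every path of `G` from `S` to `T`. -/
def Separates (G : SimpleGraph V) (S T Z : Set V) : Prop :=
  ∀ s ∈ S, ∀ t ∈ T, s ∉ Z → ¬ ReachIn G Zᶜ s t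

/-- There are `n` disjoint connected sets meeting both `S` and `T`. -/
def Joined (G : SimpleGraph V) (n : ℕ) (S T : Set V) : Prop :=
  ∃ (Q : Fin n → Set V) (s t : Fin n → V),
    (∀ i, s i ∈ S ∧ t i ∈ T ∧ s i ∈ Q i ∧ ReachIn G (Q i) (s i) (t i)) ∧
      ∀ i j v, v ∈ Q i → v ∈ Q j → i = j

variable {G H : SimpleGraph V} {S T Z P : Set V}

theorem Separates.symm (h : Separates G S T Z) : Separates G T S Z :=
  fun _ ht _ hs htZ hr => h _ hs _ ht (hr.mem htZ) hr.symm

theorem ReachIn.exists_crossing {a b : V} (h : ReachIn G P a b) (ha : a ∈ T) (hb : b ∉ T) :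
    ∃ p q, G.Adj p q ∧ p ∈ P ∧ q ∈ P ∧ p ∈ T ∧ q ∉ T := by
  by_contra! hc
  exact hb (h.closed hc ha).1

theorem ReachIn.exists_trim {s z : V} (h : ReachIn H P s z) (hs : s ∈ P) :
    ∃ R ⊆ P, s ∈ R ∧ ReachIn H R s z ∧
      ∀ v ∈ R, v = z ∨ (s ∈ P \ {z} ∧ ReachIn H (P \ {z}) s v) := by
  rcases h.first_hit hs (T := {z}) rfl with rfl | ⟨y, z, hsz, hy, hsy, hyz, hz, rfl⟩
  · exact ⟨{s}, by simpa using hs, rfl, .refl, fun v hv => Or.inl hv⟩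
  · have hs' : s ∈ P \ {z} := ⟨hs, hsz⟩
    refine ⟨insert z ((P \ {z}) ∩ {v | ReachIn H (P \ {z}) s v}), ?_, ?_, ?_, ?_⟩
    · exact Set.insert_subset hz fun v hv => hv.1.1
    · exact Or.inr ⟨hs', .refl⟩
    · have := hsy.closed (T := {v | ReachIn H (P \ {z}) s v})
        (fun a b hab ha hb hr => hr.trans (.of_adj hab ha hb)) .refl
      exact (this.2.mono (Set.subset_insert _ _)).trans
        (.of_adj hyz (Or.inr ⟨hy, this.1⟩) (Or.inl rfl))
    · rintro v (rfl | hv)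
      · exact Or.inl rfl
      · exact Or.inr ⟨hs', hv.2⟩

/-- A path of G from S to T avoiding W cannot use the extra edge before meeting `insert a Z`:
leaving a is too late, and reaching b first would join S to T in H off Z. So it is a path of H,
against one of the two separations. -/
theorem Separates.of_insert {a b : V} {W : Set V} (hZ : Separates H S T Z)
    (hGH : ∀ p q, G.Adj p q → H.Adj p q ∨ (p = a ∧ q = b) ∨ (p = b ∧ q = a))
    (hb : ∃ t ∈ T, ReachIn H Zᶜ b t) (hW : Separates H S (insert a Z) W) :
    Separates G S T W := by
  intro s hs t ht hsW hr
  have hs1 : s ∉ insert a Z := fun h => hW s hs s h hsW .refl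
  have key := hr.closed (T := {v | v ∉ insert a Z ∧ ReachIn H (Wᶜ ∩ (insert a Z)ᶜ) s v}) ?_
    ⟨hs1, .refl⟩
  · refine hZ s hs t ht (fun h => hs1 (Or.inr h)) (key.1.2.mono ?_)
    exact fun v hv h => hv.2 (Or.inr h)
  rintro p q hpq hp hq ⟨hpZ, hpr⟩
  have hH : H.Adj p q := by
    rcases hGH p q hpq with h | ⟨rfl, rfl⟩ | ⟨rfl, rfl⟩
    · exact h
    · exact absurd (Or.inl rfl) hpZ
    · obtain ⟨t', ht', hr'⟩ := hb
      refine absurd (ReachIn.trans (hpr.mono ?_) hr') (hZ s hs t' ht' fun h => hs1 (Or.inr h))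
      exact fun v hv h => hv.2 (Or.inr h)
  have hqZ : q ∉ insert a Z := fun h =>
    hW s hs q h hsW ((hpr.mono Set.inter_subset_left).trans (.of_adj hH hp hq))
  exact ⟨hqZ, hpr.trans (.of_adj hH ⟨hp, hpZ⟩ ⟨hq, hqZ⟩)⟩

/-- Trimmed linkages to a separator of minimum size. -/
theorem Joined.exists_trim {n : ℕ} {Y : Finset V} (h : Joined H n S Y) (hY : Y.card ≤ n) :
    Y.card = n ∧ ∃ (Q : Fin n → Set V) (s z : Fin n → V),
      (∀ i, s i ∈ S ∧ s i ∈ Q i ∧ ReachIn H (Q i) (s i) (z i)) ∧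
      (∀ i j v, v ∈ Q i → v ∈ Q j → i = j) ∧ (∀ i, z i ∈ Y) ∧ (∀ y ∈ Y, ∃ i, z i = y) ∧
      ∀ i, ∀ v ∈ Q i, v = z i ∨ (v ∉ Y ∧ s i ∉ Y ∧ ReachIn H (Y : Set V)ᶜ (s i) v) := by
  classical
  obtain ⟨P, s, z, h1, h2⟩ := h
  have hzP : ∀ i, z i ∈ P i := fun i => (h1 i).2.2.2.mem (h1 i).2.2.1
  have hinj : Function.Injective z := fun i j hij => h2 i j (z i) (hzP i) (hij ▸ hzP j)
  have himg : Finset.univ.image z ⊆ Y := by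
    intro v hv
    obtain ⟨i, -, rfl⟩ := Finset.mem_image.1 hv
    exact (h1 i).2.1
  have hcard : (Finset.univ.image z).card = n := by
    rw [Finset.card_image_of_injective _ hinj]; simp
  have heq : Finset.univ.image z = Y := Finset.eq_of_subset_of_card_le himg (by omega)
  have hsurj : ∀ y ∈ Y, ∃ i, z i = y := by
    intro y hy
    rw [← heq] at hy
    simpa using hy
  have hav : ∀ i, P i \ {z i} ⊆ (Y : Set V)ᶜ := by
    intro i v hv hvY
    obtain ⟨j, rfl⟩ := hsurj v hvY
    obtain rfl := h2 i j _ hv.1 (hzP j)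
    exact hv.2 rfl
  choose R hRP hsR hRr hR using fun i => (h1 i).2.2.2.exists_trim (h1 i).2.2.1
  refine ⟨by rw [← heq, hcard], R, s, z, fun i => ⟨(h1 i).1, hsR i, hRr i⟩,
    fun i j v hi hj => h2 i j v (hRP i hi) (hRP j hj), fun i => (h1 i).2.1, hsurj, ?_⟩
  intro i v hv
  refine (hR i v hv).imp_right fun h => ?_
  exact ⟨hav i (h.2.mem h.1), hav i h.1, h.2.mono (hav i)⟩

/-- **Menger's theorem** for sets of vertices of a finite graph. -/
theorem joined_of_forall_separates [Fintype V] (n : ℕ) (S T : Set V)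
    (h : ∀ Z : Finset V, Separates G S T Z → n ≤ Z.card) : Joined G n S T := by
  classical
  generalize hm : (adjPairs G).card = m
  induction m using Nat.strong_induction_on generalizing G S T with
  | _ m ih =>
  obtain hm0 | hpos := Nat.eq_zero_or_pos m
  · have hno : ∀ a b, ¬ G.Adj a b := by
      intro a b hab
      have : (a, b) ∈ adjPairs G := by simpa using hab
      rw [Finset.card_eq_zero.1 (hm.trans hm0)] at this
      simp at this
    have hc := h (S ∩ T).toFinset fun s hs t ht hsZ hr => by
      obtain rfl := hr.eq_of_forall_not_adj fun c _ _ => hno _ _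
      simp [hs, ht] at hsZ
    obtain ⟨U, hU, hUc⟩ := Finset.exists_subset_card_eq hc
    let e := U.equivFinOfCardEq hUc
    have hmem : ∀ i, (e.symm i).1 ∈ S ∧ (e.symm i).1 ∈ T := fun i => by
      have := hU (e.symm i).2
      simpa using this
    refine ⟨fun i => {(e.symm i).1}, fun i => e.symm i, fun i => e.symm i,
      fun i => ⟨(hmem i).1, (hmem i).2, rfl, .refl⟩, fun i j v hi hj => ?_⟩
    have h1 : v = (e.symm i).1 := hi
    have h2 : v = (e.symm j).1 := hj
    exact e.symm.injective (Subtype.ext (h1.symm.trans h2))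
  obtain ⟨⟨x, y⟩, hxy⟩ := Finset.card_pos.1 (hm.symm ▸ hpos)
  rw [mem_adjPairs] at hxy
  obtain ⟨H, hHG, hlt, hGH⟩ : ∃ H ≤ G, (adjPairs H).card < m ∧
      ∀ p q, G.Adj p q → H.Adj p q ∨ (p = x ∧ q = y) ∨ (p = y ∧ q = x) := by
    refine ⟨G.deleteEdges {s(x, y)}, G.deleteEdges_le _, ?_, fun p q hpq => ?_⟩
    · rw [← hm]
      refine Finset.card_lt_card ⟨fun p => by simp +contextual, fun h => ?_⟩
      have := @h (x, y) (by simpa using hxy)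
      simp at this
    · simp [hpq]
      tauto
  by_cases hH : ∀ Z : Finset V, Separates H S T Z → n ≤ Z.card
  · obtain ⟨Q, s, t, h1, h2⟩ := ih _ hlt S T hH rfl
    exact ⟨Q, s, t, fun i => ⟨(h1 i).1, (h1 i).2.1, (h1 i).2.2.1,
      (h1 i).2.2.2.mono_graph hHG⟩, h2⟩
  push Not at hH
  -- Z is too small to separate in G, so the deleted edge runs from a on the S-side of Z to b on the
  -- T-side. Adding one end to Z leaves at most n vertices, yet n disjoint paths lead there from S
  -- (for a) and from T (for b). They are glued at Z and along ab.
  obtain ⟨Z, hZ, hZn⟩ := hH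
  have hZG : ¬ Separates G S T Z := fun hs => absurd (h Z hs) (by omega)
  simp only [Separates, not_forall, not_not] at hZG
  obtain ⟨s₀, hs₀, t₀, ht₀, hs₀Z, hr₀⟩ := hZG
  set A : Set V := {v | v ∉ (Z : Set V) ∧ ∃ s ∈ S, s ∉ (Z : Set V) ∧ ReachIn H (Z : Set V)ᶜ s v} with hA
  set B : Set V := {v | v ∉ (Z : Set V) ∧ ∃ t ∈ T, ReachIn H (Z : Set V)ᶜ v t} with hB
  have hAB : ∀ v, v ∈ A → v ∉ B := by
    rintro v ⟨-, s, hs, hsZ, hsv⟩ ⟨-, t, ht, hvt⟩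
    exact hZ s hs t ht hsZ (hsv.trans hvt)
  have ht₀Z := hr₀.mem hs₀Z
  have hsA : s₀ ∈ A := ⟨hs₀Z, s₀, hs₀, hs₀Z, .refl⟩
  have htB : t₀ ∈ B := ⟨ht₀Z, t₀, ht₀, .refl⟩
  obtain ⟨a, b, hab, haZ, hbZ, haA, hbA⟩ := hr₀.exists_crossing hsA fun h => hAB _ h htB
  have hnH : ¬ H.Adj a b := by
    intro hadj
    obtain ⟨_, s, hs, hsZ, hsa⟩ := haA
    exact hbA ⟨hbZ, s, hs, hsZ, hsa.trans (.of_adj hadj haZ hbZ)⟩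
  have hGH' : ∀ p q, G.Adj p q → H.Adj p q ∨ (p = a ∧ q = b) ∨ (p = b ∧ q = a) := by
    intro p q hpq
    have := hGH a b hab
    have := hGH p q hpq
    grind
  have hbB : b ∈ B := by
    obtain ⟨c, d, hcd, hcZ, hdZ, hcB, hdB⟩ := hr₀.symm.exists_crossing htB (hAB _ hsA)
    rcases hGH' c d hcd with h | ⟨rfl, rfl⟩ | ⟨rfl, rfl⟩
    · obtain ⟨_, t, ht, hct⟩ := hcB
      exact absurd ⟨hdZ, t, ht, (ReachIn.of_adj h.symm hdZ hcZ).trans hct⟩ hdB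
    · exact absurd hcB (hAB _ haA)
    · exact hcB
  have hS : Joined H n S (insert a Z : Finset V) := by
    refine ih _ hlt S _ (fun W hW => h W ?_) rfl
    rw [Finset.coe_insert] at hW
    exact hZ.of_insert hGH' hbB.2 hW
  have hT : Joined H n T (insert b Z : Finset V) := by
    refine ih _ hlt T _ (fun W hW => h W (Separates.symm ?_)) rfl
    rw [Finset.coe_insert] at hW
    refine hZ.symm.of_insert (a := b) (b := a) (fun p q hpq => ?_) ?_ hW
    · have := hGH' p q hpq
      tauto
    · obtain ⟨_, s, hs, _, hsa⟩ := haA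
      exact ⟨s, hs, hsa.symm⟩
  obtain ⟨-, P, s, z, hP1, hP2, hP3, -, hP5⟩ :=
    hS.exists_trim ((Finset.card_insert_le _ _).trans (by omega))
  obtain ⟨-, R, t, w, hR1, hR2, hR3, hR4, hR5⟩ :=
    hT.exists_trim ((Finset.card_insert_le _ _).trans (by omega))
  -- The path ending in a continues across the edge ab, every other one at the same vertex of Z.
  have hφ : ∀ i, ∃ j, w j = if z i = a then b else z i := by
    intro i
    refine hR4 _ ?_
    have := hP3 i
    split_ifs with hi
    · exact Finset.mem_insert_self _ _
    · exact Finset.mem_insert_of_mem (Finset.mem_of_mem_insert_of_ne this hi)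
  choose φ hφ using hφ
  have hsub : ∀ c, ((insert c Z : Finset V) : Set V)ᶜ ⊆ (Z : Set V)ᶜ := fun c =>
    Set.compl_subset_compl.2 (Finset.coe_subset.2 (Finset.subset_insert _ _))
  have hPA : ∀ i, ∀ v ∈ P i, (v = z i ∧ v ∈ Z) ∨ v ∈ A := by
    intro i v hv
    rcases hP5 i v hv with rfl | ⟨h1, h2, h3⟩
    · rcases Finset.mem_insert.1 (hP3 i) with h | h
      · rw [h]; exact Or.inr haA
      · exact Or.inl ⟨rfl, h⟩
    · simp only [Finset.mem_insert, not_or] at h1 h2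
      exact Or.inr ⟨h1.2, s i, (hP1 i).1, h2.2, h3.mono (hsub a)⟩
  have hRB : ∀ j, ∀ v ∈ R j, (v = w j ∧ v ∈ Z) ∨ v ∈ B := by
    intro j v hv
    rcases hR5 j v hv with rfl | ⟨h1, h2, h3⟩
    · by_cases h : w j ∈ Z
      · exact Or.inl ⟨rfl, h⟩
      · have : w j = b := by
          simpa [h] using hR3 j
        rw [this]; exact Or.inr hbB
    · simp only [Finset.mem_insert, not_or] at h1 h2
      exact Or.inr ⟨h1.2, t j, (hR1 j).1, (h3.mono (hsub b)).symm⟩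
  have hAZ : ∀ v, v ∈ A → v ∉ Z := fun v hv => hv.1
  have hBZ : ∀ v, v ∈ B → v ∉ Z := fun v hv => hv.1
  refine ⟨fun i => P i ∪ R (φ i), s, fun i => t (φ i), fun i => ⟨(hP1 i).1, (hR1 _).1,
    Or.inl (hP1 i).2.1, ?_⟩, ?_⟩
  · refine (((hP1 i).2.2.mono_graph hHG).mono Set.subset_union_left).trans (.trans ?_
      (((hR1 (φ i)).2.2.mono_graph hHG).mono Set.subset_union_right).symm)
    have h1 : z i ∈ P i := (hP1 i).2.2.mem (hP1 i).2.1
    have h2 : w (φ i) ∈ R (φ i) := (hR1 _).2.2.mem (hR1 _).2.1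
    by_cases hi : z i = a
    · have := hφ i
      rw [if_pos hi] at this
      exact .of_adj (by rw [hi, this]; exact hab) (Or.inl h1) (Or.inr h2)
    · have := hφ i
      rw [if_neg hi] at this
      rw [this]; exact .refl
  · have hcross : ∀ i j v, v ∈ P i → v ∈ R (φ j) → i = j := by
      intro i j v hi hj
      have hw := hφ j
      rcases hPA i v hi with ⟨h1, h2⟩ | h1 <;> rcases hRB _ v hj with ⟨h3, h4⟩ | h3
      · by_cases hja : z j = a
        · rw [if_pos hja] at hw
          exact absurd (by rwa [← hw, ← h3]) hbZ
        · rw [if_neg hja] at hw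
          have hz : z i = z j := by rw [← h1, h3, hw]
          exact hP2 i j (z i) ((hP1 i).2.2.mem (hP1 i).2.1)
            (hz ▸ (hP1 j).2.2.mem (hP1 j).2.1)
      · exact absurd h2 (hBZ v h3)
      · exact absurd h4 (hAZ v h1)
      · exact absurd h3 (hAB v h1)
    have hφinj : ∀ i j, φ i = φ j → i = j := by
      intro i j hij
      have hz : z i = z j := by
        have h1 := hφ i
        rw [hij, hφ j] at h1
        have hi := hP3 i
        have hj := hP3 j
        have : b ∉ Z := hbZ
        grind
      exact hP2 i j (z i) ((hP1 i).2.2.mem (hP1 i).2.1) (hz ▸ (hP1 j).2.2.mem (hP1 j).2.1)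
    rintro i j v (hi | hi) (hj | hj)
    · exact hP2 i j v hi hj
    · exact hcross i j v hi hj
    · exact (hcross j i v hj hi).symm
    · exact hφinj i j (hR2 _ _ v hi hj)

end Menger

/-! ### Rooted models: contraction and restriction to one side of a tight separation. -/

section Rooted

variable {V W : Type*} {k : ℕ}

/-- The pairs `x (i, false)`, `x (i, true)` are joined by disjoint connected sets. -/
def Linked (G : SimpleGraph V) (x : Fin k × Bool → V) : Prop :=
  ∃ C : Fin k → Set V, (∀ i, x (i, false) ∈ C i ∧
    ReachIn G (C i) (x (i, false)) (x (i, true))) ∧ ∀ i j v, v ∈ C i → v ∈ C j → i = j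

/-- `A` and `B` cover the graph, and no edge joins `A \ B` to `B \ A`. -/
def IsSeparation (G : SimpleGraph V) (A B : Finset V) : Prop :=
  (∀ v, v ∈ A ∨ v ∈ B) ∧ ∀ a b, G.Adj a b → a ∉ B → b ∈ A

theorem IsSeparation.mem_of_notMem_left {G : SimpleGraph V} {A B : Finset V}
    (h : IsSeparation G A B) {v : V} (hv : v ∉ A) : v ∈ B := (h.1 v).resolve_left hv

theorem IsSeparation.mem_of_notMem_right {G : SimpleGraph V} {A B : Finset V}
    (h : IsSeparation G A B) {v : V} (hv : v ∉ B) : v ∈ A := (h.1 v).resolve_right hv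

theorem IsSeparation.mem_right_of_adj {G : SimpleGraph V} {A B : Finset V}
    (h : IsSeparation G A B) {a b : V} (hab : G.Adj a b) (ha : a ∉ A) : b ∈ B := by
  by_contra hb
  exact ha (h.2 b a hab.symm hb)

/-- A model of `M` in `G` that cannot be separated from the roots `x` by fewer than `2 * k`
vertices. Branch sets may be disconnected if all their components contain roots, and edges of `M`
between branch sets that both contain roots need not be realized. -/
structure IsRooted [DecidableEq V] (G : SimpleGraph V) (x : Fin k × Bool → V) (M : SimpleGraph W)
    (f : V → Option W) : Prop where
  nonempty : ∀ w, ∃ v, f v = some w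
  conn : ∀ w, (∀ v v', f v = some w → f v' = some w → ReachIn G {z | f z = some w} v v') ∨
    ∀ v, f v = some w → ∃ i, f (x i) = some w ∧ ReachIn G {z | f z = some w} v (x i)
  adj : ∀ w w', M.Adj w w' → (∀ i, f (x i) ≠ some w) →
    ∃ v v', f v = some w ∧ f v' = some w' ∧ G.Adj v v'
  inj : Function.Injective x
  sep : ∀ A B, IsSeparation G A B → (∀ i, x i ∈ A) → (∃ w, ∀ v, f v = some w → v ∉ A) →
    2 * k ≤ (A ∩ B).card

section Contract

variable {G : SimpleGraph V} {u v : V}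

theorem ReachIn.map_merge (huv : u ≠ v) {S : Set V} {R : Set {z // z ≠ v}} {a b : V}
    (hR : ∀ z ∈ S, merge huv z ∈ R) (h : ReachIn G S a b) :
    ReachIn (G.map (merge huv)) R (merge huv a) (merge huv b) := by
  refine h.map fun p q hpq hp hq => ?_
  by_cases he : merge huv p = merge huv q
  · rw [he]; exact .refl
  · exact .of_adj (SimpleGraph.map_adj_apply' hpq he) (hR p hp) (hR q hq)

theorem ReachIn.of_map_merge (huv : G.Adj u v) {R : Set {z // z ≠ v}} {a b : V}
    (h : ReachIn (G.map (merge huv.ne)) R (merge huv.ne a) (merge huv.ne b))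
    (ha : merge huv.ne a ∈ R) : ReachIn G (merge huv.ne ⁻¹' R) a b := by
  have fib : ∀ p q, merge huv.ne p = merge huv.ne q → merge huv.ne p ∈ R →
      ReachIn G (merge huv.ne ⁻¹' R) p q := fun p q hpq hp =>
    (merge_conn huv.ne huv hpq).mono fun z hz => by
      have hz : merge huv.ne z = merge huv.ne p := hz
      simpa [hz] using hp
  generalize hc : merge huv.ne a = c at h
  generalize hd : merge huv.ne b = d at h
  induction h using Relation.ReflTransGen.head_induction_on generalizing a with
  | refl => exact fib a b (hc.trans hd.symm) ha
  | head h _ ih =>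
    obtain ⟨⟨-, p, q, hpq, rfl, rfl⟩, hp, hq⟩ := h
    exact (fib a p hc ha).trans (.trans (.of_adj hpq hp hq) (ih hq rfl))

theorem Linked.of_contract (huv : G.Adj u v) {x : Fin k × Bool → V}
    (h : Linked (G.map (merge huv.ne)) (merge huv.ne ∘ x)) : Linked G x := by
  obtain ⟨C, h1, h2⟩ := h
  exact ⟨fun i => merge huv.ne ⁻¹' C i, fun i => ⟨(h1 i).1, (h1 i).2.of_map_merge huv (h1 i).1⟩,
    fun i j v hi hj => h2 i j _ hi hj⟩

variable [Fintype V] [DecidableEq V]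

/-- A separation of the contracted graph lifts to G with at most one new separator vertex, namely v.
In that case `ht` supplies the extra 1. -/
theorem IsRooted.contract {x : Fin k × Bool → V} {M : SimpleGraph W} {f : V → Option W}
    (h : IsRooted G x M f) (huv : G.Adj u v) (hv : ∀ i, x i ≠ v)
    (hf : f u = f v ∨ f u = none ∨ f v = none)
    (ht : ∀ A B, IsSeparation G A B → (∀ i, x i ∈ A) → (∃ w, ∀ v, f v = some w → v ∉ A) →
      v ∈ A → v ∈ B → 2 * k < (A ∩ B).card) :
    IsRooted (G.map (merge huv.ne)) (merge huv.ne ∘ x) M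
      fun z => if z.1 = u then (f u).or (f v) else f z := by
  classical
  set π := merge huv.ne with hπ
  set f' : {z // z ≠ v} → Option W := fun z => if z.1 = u then (f u).or (f v) else f z with hf'
  have hπv : π v = ⟨u, huv.ne⟩ := merge_self _
  have hπn : ∀ z (hz : z ≠ v), π z = ⟨z, hz⟩ := fun z hz => merge_of_ne _ hz
  have fwd : ∀ z w, f z = some w → f' (π z) = some w := by
    intro z w hz
    by_cases hzv : z = v
    · subst hzv
      rw [hπv]
      rcases hf with h | h | h <;> simp_all
    · rw [hπn z hzv]
      by_cases hzu : z = u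
      · subst hzu; simp [hf', hz]
      · simp [hf', hz, hzu]
  have bwd : ∀ y w, f' y = some w → ∃ z, π z = y ∧ f z = some w := by
    rintro ⟨y, hy⟩ w hw
    by_cases hyu : y = u
    · subst hyu
      simp only [hf', if_true, Option.or_eq_some_iff] at hw
      rcases hw with hw | ⟨-, hw⟩
      · exact ⟨y, hπn y hy, hw⟩
      · exact ⟨v, hπv, hw⟩
    · simp only [hf', hyu, if_false] at hw
      exact ⟨y, hπn y hy, hw⟩
  have fib : ∀ w a b, ReachIn G {z | f z = some w} a b →
      ReachIn (G.map π) {z | f' z = some w} (π a) (π b) := fun w a b hab =>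
    hab.map_merge huv.ne fun z hz => fwd z w hz
  refine ⟨fun w => ?_, fun w => ?_, fun w w' hww hw => ?_, fun i j hij => ?_,
    fun A B hAB hA hw => ?_⟩
  · obtain ⟨v, hv⟩ := h.nonempty w
    exact ⟨_, fwd v w hv⟩
  · refine (h.conn w).imp (fun hc y y' hy hy' => ?_) fun hc y hy => ?_
    · obtain ⟨z, rfl, hz⟩ := bwd y w hy
      obtain ⟨z', rfl, hz'⟩ := bwd y' w hy'
      exact fib w _ _ (hc z z' hz hz')
    · obtain ⟨z, rfl, hz⟩ := bwd y w hy
      obtain ⟨i, hi, hr⟩ := hc z hz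
      exact ⟨i, fwd _ _ hi, fib w _ _ hr⟩
  · obtain ⟨p, q, hp, hq, hpq⟩ := h.adj w w' hww fun i hi => hw i (fwd _ _ hi)
    refine ⟨π p, π q, fwd _ _ hp, fwd _ _ hq, SimpleGraph.map_adj_apply' hpq fun he => ?_⟩
    have hne := hww.ne
    rcases merge_eq_merge huv.ne he with h | ⟨rfl, rfl⟩ | ⟨rfl, rfl⟩
    · exact hpq.ne h
    · simp_all
    · simp_all
  · rcases merge_eq_merge huv.ne hij with h' | h' | h'
    · exact h.inj h'
    · exact absurd h'.2 (hv j)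
    · exact absurd h'.1 (hv i)
  · have hS : IsSeparation G ({z | π z ∈ A} : Finset V) ({z | π z ∈ B} : Finset V) := by
      refine ⟨fun z => by simpa using hAB.1 (π z), fun a b hab ha => ?_⟩
      simp only [Finset.mem_filter, Finset.mem_univ, true_and] at ha ⊢
      by_cases he : π a = π b
      · rw [← he]; exact hAB.mem_of_notMem_right ha
      · exact hAB.2 _ _ (SimpleGraph.map_adj_apply' hab he) ha
    have hx : ∀ i, x i ∈ ({z | π z ∈ A} : Finset V) := fun i => by simpa using hA i
    have hw' : ∃ w, ∀ v, f v = some w → v ∉ ({z | π z ∈ A} : Finset V) := by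
      obtain ⟨w, hw⟩ := hw
      exact ⟨w, fun z hz => by simpa using hw _ (fwd _ _ hz)⟩
    have hsub : (({z | π z ∈ A} : Finset V) ∩ ({z | π z ∈ B} : Finset V)).erase v ⊆
        (A ∩ B).image Subtype.val := by
      intro z hz
      simp only [Finset.mem_erase, Finset.mem_inter, Finset.mem_filter, Finset.mem_univ,
        true_and] at hz
      rw [hπn z hz.1] at hz
      exact Finset.mem_image.2 ⟨_, Finset.mem_inter.2 hz.2, rfl⟩
    have hc := (Finset.card_le_card hsub).trans Finset.card_image_le
    by_cases hvm : v ∈ (({z | π z ∈ A} : Finset V) ∩ ({z | π z ∈ B} : Finset V))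
    · have h1 := ht _ _ hS hx hw' (Finset.mem_inter.1 hvm).1 (Finset.mem_inter.1 hvm).2
      rw [Finset.card_erase_of_mem hvm] at hc
      omega
    · have h1 := h.sep _ _ hS hx hw'
      rw [Finset.erase_eq_of_notMem hvm] at hc
      omega

end Contract

section Tight

variable {G : SimpleGraph V} {x : Fin k × Bool → V} {A B : Finset V}

/-- `Q j` meets B at most in `y j`, so links inside B can be prolonged to the roots without
collisions. -/
theorem Linked.of_restrict {Q : Fin k × Bool → Set V} {y : Fin k × Bool → V}
    (h1 : ∀ j, x j ∈ Q j ∧ ReachIn G (Q j) (x j) (y j)) (h2 : ∀ j, y j ∈ A ∧ y j ∈ B)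
    (h4 : ∀ j, ∀ v ∈ Q j, v = y j ∨ v ∉ B) (h5 : ∀ i j v, v ∈ Q i → v ∈ Q j → i = j)
    (h : Linked (G.induce (B : Set V)) (fun j => ⟨y j, (h2 j).2⟩)) : Linked G x := by
  obtain ⟨C, hC1, hC2⟩ := h
  have hyC : ∀ j, (⟨y j, (h2 j).2⟩ : (B : Set V)) ∈ C j.1 := by
    rintro ⟨i, b⟩
    cases b
    · exact (hC1 i).1
    · exact (hC1 i).2.mem (hC1 i).1
  have hcross : ∀ i j v, v ∈ Subtype.val '' C i → v ∈ Q j → i = j.1 := by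
    rintro i j v ⟨z, hz, rfl⟩ hv
    rcases h4 j _ hv with h | h
    · exact hC2 i j.1 z hz (by rw [show z = ⟨y j, (h2 j).2⟩ from Subtype.ext h]; exact hyC j)
    · exact absurd z.2 h
  refine ⟨fun i => Subtype.val '' C i ∪ (Q (i, false) ∪ Q (i, true)), fun i => ⟨?_, ?_⟩, ?_⟩
  · exact Or.inr (Or.inl (h1 _).1)
  · refine ((h1 (i, false)).2.mono fun v hv => Or.inr (Or.inl hv)).trans (.trans ?_
      ((h1 (i, true)).2.mono fun v hv => Or.inr (Or.inr hv)).symm)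
    exact (hC1 i).2.of_induce.mono fun v hv => Or.inl hv
  · rintro i j v (hi | hi | hi) (hj | hj | hj)
    · obtain ⟨a, ha, rfl⟩ := hi
      obtain ⟨b, hb, hab⟩ := hj
      rw [Subtype.ext hab] at hb
      exact hC2 i j a ha hb
    · exact hcross _ _ _ hi hj
    · exact hcross _ _ _ hi hj
    · exact (hcross _ _ _ hj hi).symm
    · exact congrArg Prod.fst (h5 _ _ v hi hj)
    · exact congrArg Prod.fst (h5 _ _ v hi hj)
    · exact (hcross _ _ _ hj hi).symm
    · exact congrArg Prod.fst (h5 _ _ v hi hj)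
    · exact congrArg Prod.fst (h5 _ _ v hi hj)

variable [DecidableEq V] {M : SimpleGraph W} {f : V → Option W}

/-- A path from v inside the branch set, towards a or towards a root (which lies in A), stays in B
until it first hits A. -/
theorem IsRooted.meets (h : IsRooted G x M f) (hAB : IsSeparation G A B)
    (hx : ∀ i, x i ∈ A) {w : W} {v a : V} (hv : f v = some w) (hvB : v ∈ B)
    (ha : f a = some w) (haA : a ∈ A) :
    ∃ z ∈ A, z ∈ B ∧ f z = some w ∧ ReachIn G ({z | f z = some w} ∩ B) v z := by
  have main : ∀ a, a ∈ A → ReachIn G {z | f z = some w} v a →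
      ∃ z ∈ A, z ∈ B ∧ f z = some w ∧ ReachIn G ({z | f z = some w} ∩ B) v z := by
    intro a haA hr
    rcases hr.first_hit (T := (A : Set V)) hv haA with hvA | ⟨y, z, hvA, hy, hr, hyz, hz, hzA⟩
    · exact ⟨v, hvA, hvB, hv, .refl⟩
    · have hzB := hAB.mem_right_of_adj hyz hy.2
      have hsub : {z | f z = some w} \ (A : Set V) ⊆ {z | f z = some w} ∩ B := fun z hz =>
        ⟨hz.1, hAB.mem_of_notMem_left hz.2⟩
      exact ⟨z, hzA, hzB, hz, (hr.mono hsub).trans (.of_adj hyz (hsub hy) ⟨hz, hzB⟩)⟩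
  rcases h.conn w with hc | hc
  · exact main a haA (hc v a hv ha)
  · obtain ⟨i, -, hr⟩ := hc v hv
    exact main _ (hx i) hr

/-- The roots are linked to a tight separator inside the side that contains them. -/
theorem IsRooted.exists_paths [Fintype V] (h : IsRooted G x M f) (hAB : IsSeparation G A B)
    (hx : ∀ i, x i ∈ A) (hw : ∃ w, ∀ v, f v = some w → v ∉ A) (hc : (A ∩ B).card ≤ 2 * k) :
    ∃ (Q : Fin k × Bool → Set V) (y : Fin k × Bool → V),
      (∀ j, x j ∈ Q j ∧ ReachIn G (Q j) (x j) (y j)) ∧ (∀ j, y j ∈ A ∧ y j ∈ B) ∧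
      (∀ z, z ∈ A → z ∈ B → ∃ j, y j = z) ∧
      (∀ j, ∀ v ∈ Q j, v = y j ∨ v ∉ B) ∧ ∀ i j v, v ∈ Q i → v ∈ Q j → i = j := by
  classical
  have hJ : Joined G (2 * k) (Set.range x) (A ∩ B : Finset V) := by
    refine joined_of_forall_separates _ _ _ fun Z hZ => ?_
    -- R is what the roots reach inside A off Z. The separation with sides R ∪ (Z ∩ A) and the
    -- complement of R still cuts off a branch set, and its separator lies in Z, so |Z| ≥ 2k.
    set R : Finset V := {v | ∃ i, x i ∉ Z ∧ ReachIn G ((Z : Set V)ᶜ ∩ A) (x i) v} with hR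
    have hRA : ∀ v ∈ R, v ∈ A ∧ v ∉ Z ∧ v ∉ B := by
      intro v hv
      obtain ⟨i, hi, hr⟩ := (Finset.mem_filter.1 hv).2
      have hm := hr.mem ⟨hi, hx i⟩
      refine ⟨hm.2, hm.1, fun hB => ?_⟩
      exact hZ _ ⟨i, rfl⟩ v (Finset.mem_coe.2 (Finset.mem_inter.2 ⟨hm.2, hB⟩)) hi
        (hr.mono Set.inter_subset_left)
    have key := h.sep (R ∪ (Z ∩ A)) Rᶜ ⟨fun v => ?_, fun a b hab ha => ?_⟩ (fun i => ?_) ?_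
    · refine key.trans (Finset.card_le_card fun v hv => ?_)
      simp only [Finset.mem_inter, Finset.mem_union, Finset.mem_compl] at hv
      tauto
    · simp only [Finset.mem_union, Finset.mem_compl]
      tauto
    · simp only [Finset.mem_compl, not_not] at ha
      have hbA : b ∈ A := hAB.2 a b hab (hRA a ha).2.2
      by_cases hbZ : b ∈ Z
      · simp [hbZ, hbA]
      · refine Finset.mem_union_left _ ?_
        obtain ⟨i, hi, hr⟩ := (Finset.mem_filter.1 ha).2
        exact Finset.mem_filter.2 ⟨Finset.mem_univ _, i, hi,
          hr.trans (.of_adj hab ⟨(hRA a ha).2.1, (hRA a ha).1⟩ ⟨hbZ, hbA⟩)⟩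
    · by_cases hi : x i ∈ Z
      · simp [hi, hx i]
      · exact Finset.mem_union_left _ (Finset.mem_filter.2 ⟨Finset.mem_univ _, i, hi, .refl⟩)
    · obtain ⟨w, hw⟩ := hw
      refine ⟨w, fun v hv hvm => hw v hv ?_⟩
      rcases Finset.mem_union.1 hvm with h' | h'
      · exact (hRA v h').1
      · exact (Finset.mem_inter.1 h').2
  obtain ⟨-, Q, s, z, h1, h2, h3, h4, h5⟩ := hJ.exists_trim hc
  choose r hr using fun i => (h1 i).1
  have hrinj : Function.Injective r := fun i j hij =>
    h2 i j (s i) (h1 i).2.1 (by rw [← hr i, hij, hr j]; exact (h1 j).2.1)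
  have hrbij : Function.Bijective r :=
    (Fintype.bijective_iff_injective_and_card r).2 ⟨hrinj, by simp; ring⟩
  let e := Equiv.ofBijective r hrbij
  have he : ∀ j, x j = s (e.symm j) := fun j => by
    rw [← hr]; congr 1; exact (e.apply_symm_apply j).symm
  refine ⟨fun j => Q (e.symm j), fun j => z (e.symm j), fun j => ?_, fun j => ?_, fun v hA hB => ?_,
    fun j v hv => ?_, fun i j v hi hj => ?_⟩
  · rw [he]; exact (h1 _).2
  · simpa using h3 (e.symm j)
  · obtain ⟨i, rfl⟩ := h4 v (Finset.mem_inter.2 ⟨hA, hB⟩)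
    exact ⟨e i, by simp⟩
  · refine (h5 _ v hv).imp_right fun ⟨hvY, hsY, hr⟩ => ?_
    have hsB : s (e.symm j) ∉ B := fun hB =>
      hsY (Finset.mem_inter.2 ⟨by rw [← he]; exact hx j, hB⟩)
    refine (hr.closed (S := ((A ∩ B : Finset V) : Set V)ᶜ) (T := {v | v ∉ B}) (fun a b hab ha hb haB hbB => hb ?_) hsB).1
    exact Finset.mem_coe.2 (Finset.mem_inter.2 ⟨hAB.2 a b hab haB, hbB⟩)
  · exact e.symm.injective (h2 _ _ v hi hj)

variable [Fintype W] [DecidableEq W]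

/-- A branch set missing B is not adjacent in M to `w₀`, which misses A, so the two have at least 4k
common neighbours. Each of these must meet A ∩ B, which has at most 2k vertices. -/
theorem IsRooted.exists_mem_right (hk : 0 < k) (hM : IsDense k M) (h : IsRooted G x M f)
    (hAB : IsSeparation G A B) (hx : ∀ i, x i ∈ A) {w₀ : W} (hw₀ : ∀ v, f v = some w₀ → v ∉ A)
    (hc : (A ∩ B).card ≤ 2 * k) (w : W) : ∃ v ∈ B, f v = some w := by
  by_contra! hno
  have hwB : ∀ v, f v = some w → v ∉ B := fun v hv hB => hno v hB hv
  have hxw : ∀ w, (∀ v, f v = some w → v ∉ A) → ∀ i, f (x i) ≠ some w :=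
    fun w hw i hi => hw _ hi (hx i)
  have hnadj : ¬ M.Adj w₀ w := by
    intro hadj
    obtain ⟨p, q, hp, hq, hpq⟩ := h.adj _ _ hadj (hxw _ hw₀)
    exact hwB q hq (hAB.mem_right_of_adj hpq (hw₀ p hp))
  have hne : w₀ ≠ w := by
    rintro rfl
    obtain ⟨v, hv⟩ := h.nonempty w₀
    exact hwB v hv (hAB.mem_of_notMem_left (hw₀ v hv))
  have hcommon := hM.le_card_common_of_not_adj hne hnadj
  have hmeet : ∀ c ∈ nbr M w₀ ∩ nbr M w, ∃ z ∈ A ∩ B, f z = some c := by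
    intro c hc
    simp only [Finset.mem_inter, mem_nbr] at hc
    obtain ⟨p, q, hp, hq, hpq⟩ := h.adj _ _ hc.1 (hxw _ hw₀)
    have hqB := hAB.mem_right_of_adj hpq (hw₀ p hp)
    by_cases hcA : ∃ a ∈ A, f a = some c
    · obtain ⟨a, haA, ha⟩ := hcA
      obtain ⟨z, hzA, hzB, hz, -⟩ := h.meets hAB hx hq hqB ha haA
      exact ⟨z, Finset.mem_inter.2 ⟨hzA, hzB⟩, hz⟩
    · push Not at hcA
      obtain ⟨p, q, hp, hq, hpq⟩ := h.adj _ _ hc.2.symm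
        (hxw c fun v hv hA => hcA v hA hv)
      exact absurd hp (hcA p (hAB.2 q p hpq.symm (hwB q hq)))
  have : Nonempty V := ⟨(h.nonempty w).choose⟩
  choose! g hg hgf using hmeet
  have := Finset.card_le_card_of_injOn g hg fun c hc c' hc' he => by
    have h1 := hgf c hc
    rw [he, hgf c' hc'] at h1
    exact (Option.some.inj h1).symm
  omega

/-- This is why `IsRooted` tolerates broken branch sets and missing edges: a branch set that meets A
may fall apart, but each piece in B contains a vertex of A ∩ B, that is, a new root. A branch set
without new roots misses A and keeps its edges. -/
theorem IsRooted.restrict [Fintype V] (hk : 0 < k) (hM : IsDense k M) (h : IsRooted G x M f)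
    (hAB : IsSeparation G A B) (hx : ∀ i, x i ∈ A) {w₀ : W} (hw₀ : ∀ v, f v = some w₀ → v ∉ A)
    (hc : (A ∩ B).card ≤ 2 * k) {y : Fin k × Bool → V} (hy : ∀ j, y j ∈ A ∧ y j ∈ B)
    (hsurj : ∀ z, z ∈ A → z ∈ B → ∃ j, y j = z) (hinj : Function.Injective y) :
    IsRooted (G.induce (B : Set V)) (fun j => ⟨y j, (hy j).2⟩) M fun z => f z.1 := by
  have hcase : ∀ w, (∀ v, f v = some w → v ∉ A) ∨ ∀ v ∈ B, f v = some w →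
      ∃ j, f (y j) = some w ∧ ReachIn G ({z | f z = some w} ∩ B) v (y j) := by
    intro w
    by_cases hA : ∃ a ∈ A, f a = some w
    · obtain ⟨a, haA, ha⟩ := hA
      refine Or.inr fun v hvB hv => ?_
      obtain ⟨z, hzA, hzB, hz, hr⟩ := h.meets hAB hx hv hvB ha haA
      obtain ⟨j, rfl⟩ := hsurj z hzA hzB
      exact ⟨j, hz, hr⟩
    · push Not at hA
      exact Or.inl fun v hv hvA => hA v hvA hv
  have hind : ∀ w (v v' : (B : Set V)), f v.1 = some w →
      ReachIn G ({z | f z = some w} ∩ B) v.1 v'.1 →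
      ReachIn (G.induce (B : Set V)) {z | f z.1 = some w} v v' := by
    intro w v v' hv hr
    obtain ⟨_, hr'⟩ := hr.to_induce Set.inter_subset_right v.2
    exact hr'.mono fun z hz => hz.1
  have hne : ∀ w, ∃ v ∈ B, f v = some w := h.exists_mem_right hk hM hAB hx hw₀ hc
  refine ⟨fun w => ?_, fun w => ?_, fun w w' hww hw => ?_, fun i j hij => ?_,
    fun A' B' hAB' hA' hw => ?_⟩
  · obtain ⟨v, hvB, hv⟩ := hne w
    exact ⟨⟨v, hvB⟩, hv⟩
  · rcases hcase w with hA | hr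
    · refine Or.inl fun v v' hv hv' => hind w v v' hv ?_
      rcases h.conn w with hc | hc
      · exact (hc v v' hv hv').mono fun z hz => ⟨hz, hAB.mem_of_notMem_left (hA z hz)⟩
      · obtain ⟨i, hi, -⟩ := hc _ hv
        exact absurd (hx i) (hA _ hi)
    · refine Or.inr fun v hv => ?_
      obtain ⟨j, hj, hr⟩ := hr v v.2 hv
      exact ⟨j, hj, hind w v ⟨y j, (hy j).2⟩ hv hr⟩
  · rcases hcase w with hA | hr
    · obtain ⟨p, q, hp, hq, hpq⟩ := h.adj w w' hww fun i hi => hA _ hi (hx i)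
      exact ⟨⟨p, hAB.mem_of_notMem_left (hA p hp)⟩, ⟨q, hAB.mem_right_of_adj hpq (hA p hp)⟩,
        hp, hq, hpq⟩
    · obtain ⟨v, hvB, hv⟩ := hne w
      obtain ⟨j, hj, -⟩ := hr v hvB hv
      exact absurd hj (hw j)
  · exact hinj (congrArg Subtype.val hij)
  · obtain ⟨w, hw⟩ := hw
    have hwA : ∀ v, f v = some w → v ∉ A := by
      rcases hcase w with hA | hr
      · exact hA
      · obtain ⟨v, hvB, hv⟩ := hne w
        obtain ⟨j, hj, -⟩ := hr v hvB hv
        exact absurd (hA' j) (hw _ hj)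
    -- Adding A to the root side turns a separation of G[B] into one of G. The separator does not
    -- grow, since A ∩ B consists of new roots, already in `A'`.
    have key := h.sep (A ∪ A'.image Subtype.val) (B'.image Subtype.val) ⟨fun v => ?_,
      fun a b hab ha => ?_⟩ (fun i => Finset.mem_union_left _ (hx i)) ⟨w, fun v hv hvA => ?_⟩
    · refine key.trans (le_trans (Finset.card_le_card ?_)
        (Finset.card_image_le (s := A' ∩ B') (f := Subtype.val)))
      intro v hv
      obtain ⟨hv1, hv2⟩ := Finset.mem_inter.1 hv
      obtain ⟨b, hb, rfl⟩ := Finset.mem_image.1 hv2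
      refine Finset.mem_image.2 ⟨b, Finset.mem_inter.2 ⟨?_, hb⟩, rfl⟩
      rcases Finset.mem_union.1 hv1 with h' | h'
      · obtain ⟨j, hj⟩ := hsurj b.1 h' b.2
        have := hA' j
        simp only [hj] at this
        exact this
      · obtain ⟨a, ha, hab⟩ := Finset.mem_image.1 h'
        rwa [← Subtype.ext hab]
    · by_cases hvA : v ∈ A
      · exact Or.inl (Finset.mem_union_left _ hvA)
      · rcases hAB'.1 ⟨v, hAB.mem_of_notMem_left hvA⟩ with h' | h'
        · exact Or.inl (Finset.mem_union_right _ (Finset.mem_image.2 ⟨_, h', rfl⟩))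
        · exact Or.inr (Finset.mem_image.2 ⟨_, h', rfl⟩)
    · by_contra hb
      simp only [Finset.mem_union, not_or] at hb
      have hbB := hAB.mem_of_notMem_left hb.1
      have haB := hAB.mem_right_of_adj hab.symm hb.1
      refine hb.2 (Finset.mem_image.2 ⟨⟨b, hbB⟩, hAB'.2 ⟨a, haB⟩ ⟨b, hbB⟩ hab fun h' => ?_, rfl⟩)
      exact ha (Finset.mem_image.2 ⟨_, h', rfl⟩)
    · rcases Finset.mem_union.1 hvA with h' | h'
      · exact hwA v hv h'
      · obtain ⟨a, ha, rfl⟩ := Finset.mem_image.1 h'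
        exact hw a hv ha

end Tight

end Rooted

/-! ### Linking when nothing can be contracted. -/

section Terminal

variable {V W : Type*} {k : ℕ} [DecidableEq V] {G : SimpleGraph V}
  {x : Fin k × Bool → V} {M : SimpleGraph W} {f : V → Option W}

/-- By `hT` a vertex that is not a root has no neighbour in its own branch set, so it is the whole
branch set. -/
theorem IsRooted.eq_of_label (h : IsRooted G x M f)
    (hT : ∀ u v, G.Adj u v → (∀ i, x i ≠ v) → ∃ w w', f u = some w ∧ f v = some w' ∧ w ≠ w')
    {w : W} {v v' : V} (hv : f v = some w) (hroot : ∀ i, x i ≠ v) (hv' : f v' = some w) :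
    v = v' := by
  have hno : ∀ c ∈ {z | f z = some w}, v ∈ {z | f z = some w} → ¬ G.Adj v c := by
    intro c hc _ hadj
    obtain ⟨a, b, ha, hb, hne⟩ := hT c v hadj.symm hroot
    have hc : f c = some w := hc
    simp_all
  rcases h.conn w with hc | hc
  · exact (hc v v' hv hv').eq_of_forall_not_adj hno
  · obtain ⟨i, -, hr⟩ := hc v hv
    exact absurd (hr.eq_of_forall_not_adj hno).symm (hroot i)

variable [Fintype V] [Fintype W] [DecidableEq W]

/-- If a set s of roots violated Hall's condition, its outside neighbours and the roots not in s
would form a separator of fewer than 2k vertices. Its root side has fewer than 4k ≤ |W| vertices, so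
it misses a branch set. -/
theorem IsRooted.exists_matching (hM : IsDense k M) [Nonempty W] (h : IsRooted G x M f) :
    ∃ n : Fin k × Bool → V, Function.Injective n ∧ ∀ i, G.Adj (x i) (n i) ∧ ∀ j, x j ≠ n i := by
  classical
  have hall := (Finset.all_card_le_biUnion_card_iff_exists_injective
    (fun i => (nbr G (x i)).filter fun v => ∀ j, x j ≠ v)).1 fun s => by
      by_contra! hlt
      set N := s.biUnion fun i => (nbr G (x i)).filter fun v => ∀ j, x j ≠ v with hN
      have hroots : (Finset.univ.image x).card ≤ 2 * k :=
        Finset.card_image_le.trans (by simp; omega)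
      have hs : s.card ≤ 2 * k := (Finset.card_le_univ s).trans (by simp; omega)
      have hcompl : (sᶜ.image x).card ≤ 2 * k - s.card := by
        refine Finset.card_image_le.trans ?_
        rw [Finset.card_compl]
        simp only [Fintype.card_prod, Fintype.card_fin, Fintype.card_bool]
        omega
      have hcard := hM.le_card
      have hA : (Finset.univ.image x ∪ N).card < 4 * k :=
        (Finset.card_union_le _ _).trans_lt (by omega)
      have key := h.sep (Finset.univ.image x ∪ N) (s.image x)ᶜ ⟨fun v => ?_, fun a b hab ha => ?_⟩
        (fun i => Finset.mem_union_left _ (Finset.mem_image_of_mem _ (Finset.mem_univ _))) ?_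
      · have hsub : (Finset.univ.image x ∪ N) ∩ (s.image x)ᶜ ⊆ sᶜ.image x ∪ N := by
          intro v hv
          simp only [Finset.mem_inter, Finset.mem_union, Finset.mem_compl, Finset.mem_image,
            Finset.mem_univ, true_and] at hv ⊢
          obtain ⟨⟨i, rfl⟩ | hv, hv'⟩ := hv
          · exact Or.inl ⟨i, fun hi => hv' ⟨i, hi, rfl⟩, rfl⟩
          · exact Or.inr hv
        have := (Finset.card_le_card hsub).trans (Finset.card_union_le _ _)
        omega
      · by_cases hv : v ∈ s.image x
        · obtain ⟨i, -, rfl⟩ := Finset.mem_image.1 hv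
          exact Or.inl (Finset.mem_union_left _ (Finset.mem_image_of_mem _ (Finset.mem_univ _)))
        · exact Or.inr (Finset.mem_compl.2 hv)
      · simp only [Finset.mem_compl, not_not] at ha
        obtain ⟨i, hi, rfl⟩ := Finset.mem_image.1 ha
        by_cases hb : ∃ j, x j = b
        · obtain ⟨j, rfl⟩ := hb
          exact Finset.mem_union_left _ (Finset.mem_image_of_mem _ (Finset.mem_univ _))
        · push Not at hb
          exact Finset.mem_union_right _ (Finset.mem_biUnion.2
            ⟨i, hi, Finset.mem_filter.2 ⟨mem_nbr.2 hab, hb⟩⟩)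
      · by_contra! hno
        choose g hg hgA using hno
        have := Finset.card_le_card_of_injOn (s := Finset.univ) g (fun w _ => hgA w)
          fun w _ w' _ he => by
            have h1 := hg w
            rw [he, hg w'] at h1
            exact (Option.some.inj h1).symm
        rw [Finset.card_univ] at this
        omega
  obtain ⟨n, hn, hn'⟩ := hall
  refine ⟨n, hn, fun i => ?_⟩
  have := hn' i
  simpa using this

/-- Linking when no edge can be contracted: branch sets are then single vertices or consist of
roots. -/
theorem IsRooted.linked_of_terminal (hM : IsDense k M) [Nonempty W] (h : IsRooted G x M f)
    (hT : ∀ u v, G.Adj u v → (∀ i, x i ≠ v) → ∃ w w', f u = some w ∧ f v = some w' ∧ w ≠ w') :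
    Linked G x := by
  classical
  obtain ⟨n, hn, hn'⟩ := h.exists_matching hM
  choose l m hl hm hlm using fun i => hT _ _ (hn' i).1 (hn' i).2
  have hsing : ∀ {w v v'}, f v = some w → (∀ i, x i ≠ v) → f v' = some w → v = v' :=
    fun hv hr hv' => h.eq_of_label hT hv hr hv'
  have hm_inj : ∀ i j, m i = m j → i = j := fun i j hij =>
    hn (hsing (hm i) (hn' i).2 (hij ▸ hm j))
  have hml : ∀ i j, m i ≠ l j := fun i j hij =>
    (hn' i).2 j (hsing (hm i) (hn' i).2 (hij ▸ hl j)).symm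
  -- A root that shares its label with no other root is its whole branch set and represents it. Any
  -- other root moves to its matched neighbour, whose branch set is a singleton.
  set alone : Fin k × Bool → Prop := fun i => ∀ j, l j = l i → j = i with halone
  set r : Fin k × Bool → V := fun i => if alone i then x i else n i with hr
  set ρ : Fin k × Bool → W := fun i => if alone i then l i else m i with hρ
  have hrρ : ∀ i, f (r i) = some (ρ i) := by
    intro i
    by_cases hi : alone i <;> simp only [hr, hρ, hi, if_true, if_false, hl, hm]
  have hrsing : ∀ i v, f v = some (ρ i) → v = r i := by
    intro i v hv
    by_cases hi : alone i
    · simp only [hr, hρ, hi, if_true] at hv ⊢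
      by_cases hvr : ∃ j, x j = v
      · obtain ⟨j, rfl⟩ := hvr
        rw [hl j, Option.some.injEq] at hv
        rw [hi j hv]
      · push Not at hvr
        exact hsing hv hvr (hl i)
    · simp only [hr, hρ, hi, if_false] at hv ⊢
      exact (hsing (hm i) (hn' i).2 hv).symm
  have hρ_inj : ∀ i j, ρ i = ρ j → i = j := by
    intro i j hij
    simp only [hρ] at hij
    split_ifs at hij with hi hj hj
    · exact hj i hij
    · exact absurd hij.symm (hml _ _)
    · exact absurd hij (hml _ _)
    · exact hm_inj i j hij
  set Z : Finset W := Finset.univ.image l ∪ (Finset.univ.filter fun i => ¬ alone i).image m with hZ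
  have hρZ : ∀ i, ρ i ∈ Z := by
    intro i
    by_cases hi : alone i
    · simp [hρ, hi, hZ]
    · simp only [hρ, hi, if_false, hZ]
      exact Finset.mem_union_right _ (Finset.mem_image_of_mem _ (by simp [hi]))
  -- A lone root uses one label. The others share their own labels at least two to one and add one
  -- each, so the 2k roots use at most 3/2 labels each.
  have hZc : Z.card ≤ 3 * k := by
    have e1 : Finset.univ.image l = (Finset.univ.filter alone).image l ∪
        (Finset.univ.filter fun i => ¬ alone i).image l := by
      rw [← Finset.image_union, Finset.filter_union_filter_not_eq]
    have e2 : 2 * ((Finset.univ.filter fun i => ¬ alone i).image l).card ≤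
        (Finset.univ.filter fun i => ¬ alone i).card := by
      refine Finset.mul_card_image_le_card _ 2 fun w hw => ?_
      obtain ⟨i, hi, rfl⟩ := Finset.mem_image.1 hw
      have hi := (Finset.mem_filter.1 hi).2
      have hi' := hi
      simp only [halone, not_forall] at hi'
      obtain ⟨j, hj, hji⟩ := hi'
      have hj' : ¬ alone j := fun h => hji (h i hj.symm).symm
      rw [← Finset.card_pair hji]
      refine Finset.card_le_card fun c hc => ?_
      rcases Finset.mem_insert.1 hc with rfl | hc
      · simp [hj', hj]
      · rw [Finset.mem_singleton.1 hc]; simp [hi]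
    have e3 : (Finset.univ.filter alone).card + (Finset.univ.filter fun i => ¬ alone i).card =
        2 * k := by
      rw [Finset.card_filter_add_card_filter_not]
      simp; omega
    have e4 := Finset.card_union_le (Finset.univ.image l)
      ((Finset.univ.filter fun i => ¬ alone i).image m)
    have e5 : (Finset.univ.image l).card ≤ _ := e1 ▸ Finset.card_union_le _ _
    have e6 := Finset.card_image_le (s := Finset.univ.filter alone) (f := l)
    have e7 := Finset.card_image_le (s := Finset.univ.filter fun i => ¬ alone i) (f := m)
    rw [← hZ] at e4
    omega
  -- Of at least 4k - 2 common neighbours, at most |Z| - 2 ≤ 3k - 2 lie in Z, as the two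
  -- representatives are in Z but not among them. The k that remain satisfy Hall's condition at
  -- once.
  obtain ⟨c, hc, hcT⟩ := (Finset.all_card_le_biUnion_card_iff_exists_injective
    (fun i : Fin k => (nbr M (ρ (i, false)) ∩ nbr M (ρ (i, true))) \ Z)).1 fun s => by
      obtain rfl | ⟨i, hi⟩ := s.eq_empty_or_nonempty
      · simp
      refine le_trans ?_ (Finset.card_le_card (Finset.subset_biUnion_of_mem _ hi))
      have h1 := hM.le_card_common (ρ (i, false)) (ρ (i, true))
      have h2 := Finset.card_sdiff_add_card_inter (nbr M (ρ (i, false)) ∩ nbr M (ρ (i, true))) Z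
      have h3 : ((nbr M (ρ (i, false)) ∩ nbr M (ρ (i, true))) ∩ Z).card + 2 ≤ Z.card := by
        have hne : ρ (i, false) ≠ ρ (i, true) := fun he => by simpa using hρ_inj _ _ he
        rw [← Finset.card_pair hne, ← Finset.card_union_of_disjoint]
        · refine Finset.card_le_card (Finset.union_subset Finset.inter_subset_right ?_)
          intro w hw
          rcases Finset.mem_insert.1 hw with rfl | hw
          · exact hρZ _
          · rw [Finset.mem_singleton.1 hw]; exact hρZ _
        · rw [Finset.disjoint_right]
          intro w hw hw'
          simp only [Finset.mem_inter, mem_nbr, Finset.mem_insert, Finset.mem_singleton] at hw hw'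
          rcases hw with rfl | rfl
          · exact hw'.1.1.ne rfl
          · exact hw'.1.2.ne rfl
      have h4 : s.card ≤ k := by simpa using Finset.card_le_univ s
      omega
  have hcZ : ∀ i, c i ∉ Z := fun i => (Finset.mem_sdiff.1 (hcT i)).2
  have hcl : ∀ i j, l j ≠ c i := fun i j he =>
    hcZ i (he ▸ Finset.mem_union_left _ (Finset.mem_image_of_mem _ (Finset.mem_univ _)))
  choose z hz using fun i => h.nonempty (c i)
  have hzx : ∀ i j, x j ≠ z i := fun i j he => by
    have h1 := hz i
    rw [← he, hl j] at h1
    exact hcl i j (Option.some.inj h1)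
  have hzr : ∀ i b, G.Adj (z i) (r (i, b)) := by
    intro i b
    have hadj : M.Adj (c i) (ρ (i, b)) := by
      have := (Finset.mem_sdiff.1 (hcT i)).1
      simp only [Finset.mem_inter, mem_nbr] at this
      cases b
      · exact this.1.symm
      · exact this.2.symm
    obtain ⟨p, q, hp, hq, hpq⟩ := h.adj _ _ hadj fun j hj => by
      rw [hl j] at hj
      exact hcl i j (Option.some.inj hj)
    rw [hsing (hz i) (hzx i) hp, ← hrsing _ q hq]
    exact hpq
  have hxr : ∀ i, x i = r i ∨ G.Adj (x i) (r i) := by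
    intro i
    by_cases hi : alone i
    · exact Or.inl (by simp [hr, hi])
    · exact Or.inr (by simpa [hr, hi] using (hn' i).1)
  have hxr' : ∀ i j, x i = r j → i = j := by
    intro i j hij
    by_cases hj : alone j
    · simp only [hr, hj, if_true] at hij
      exact h.inj hij
    · simp only [hr, hj, if_false] at hij
      exact absurd hij ((hn' j).2 i)
  have hzr' : ∀ i j, z i ≠ r j := by
    intro i j hij
    have h1 := hz i
    rw [hij, hrρ j] at h1
    exact hcZ i (Option.some.inj h1 ▸ hρZ j)
  refine ⟨fun i => {v | v = z i ∨ ∃ b, v = x (i, b) ∨ v = r (i, b)}, fun i => ?_, ?_⟩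
  · set C : Set V := {v | v = z i ∨ ∃ b, v = x (i, b) ∨ v = r (i, b)} with hC
    have hxC : ∀ b, x (i, b) ∈ C := fun b => Or.inr ⟨b, Or.inl rfl⟩
    have hrC : ∀ b, r (i, b) ∈ C := fun b => Or.inr ⟨b, Or.inr rfl⟩
    have hstep : ∀ b, ReachIn G C (x (i, b)) (z i) := by
      intro b
      refine ReachIn.trans ?_ (.of_adj (hzr i b).symm (hrC b) (Or.inl rfl))
      rcases hxr (i, b) with he | he
      · rw [← he]; exact .refl
      · exact .of_adj he (hxC b) (hrC b)
    exact ⟨hxC false, (hstep false).trans (hstep true).symm⟩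
  · rintro i j v (rfl | ⟨b, rfl | rfl⟩) (hj | ⟨b', hj | hj⟩)
    · refine hc (Option.some.inj ?_)
      rw [← hz i, hj, hz j]
    · exact absurd hj.symm (hzx i _)
    · exact absurd hj (hzr' i _)
    · exact absurd hj (hzx j _)
    · exact congrArg Prod.fst (h.inj hj)
    · exact congrArg Prod.fst (hxr' _ _ hj)
    · exact absurd hj.symm (hzr' j _)
    · exact (congrArg Prod.fst (hxr' _ _ hj.symm)).symm
    · have h1 := hrρ (i, b)
      rw [hj, hrρ] at h1
      exact (congrArg Prod.fst (hρ_inj _ _ (Option.some.inj h1))).symm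

end Terminal

/-! ### Rooted dense models link their roots. -/

section RootedLinked

variable {W : Type*} [Fintype W] [DecidableEq W] [Nonempty W] {k : ℕ} {M : SimpleGraph W}

/-- An edge uv that does not join two branch sets, with v not a root, is contracted. If a separation
of order at most 2k through v forbids this, Menger's theorem links the roots to its separator, which
becomes the root set of the far side. -/
theorem IsRooted.linked (hk : 0 < k) (hM : IsDense k M) (n : ℕ) : ∀ (V : Type u) [Fintype V]
    [DecidableEq V] (G : SimpleGraph V) (x : Fin k × Bool → V) (f : V → Option W),
    Fintype.card V = n → IsRooted G x M f → Linked G x := by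
  classical
  induction n using Nat.strong_induction_on with
  | _ n ih =>
  intro V _ _ G x f hV h
  by_cases hT : ∀ u v, G.Adj u v → (∀ i, x i ≠ v) →
      ∃ w w', f u = some w ∧ f v = some w' ∧ w ≠ w'
  · exact h.linked_of_terminal hM hT
  push Not at hT
  obtain ⟨u, v, huv, hv, hlab⟩ := hT
  have hf : f u = f v ∨ f u = none ∨ f v = none := by
    cases hu : f u with
    | none => simp
    | some a =>
      cases hv' : f v with
      | none => simp
      | some b => simp [hlab a b hu hv']
  by_cases ht : ∀ A B, IsSeparation G A B → (∀ i, x i ∈ A) → (∃ w, ∀ v, f v = some w → v ∉ A) →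
      v ∈ A → v ∈ B → 2 * k < (A ∩ B).card
  · have hc : Fintype.card {z // z ≠ v} + 1 = Fintype.card V := card_setOf_ne v
    exact Linked.of_contract huv (ih _ (by omega) _ _ _ _ rfl (h.contract huv hv hf ht))
  push Not at ht
  obtain ⟨A, B, hAB, hA, hw, hvA, hvB, hc⟩ := ht
  obtain ⟨Q, y, h1, h2, h3, h4, h5⟩ := h.exists_paths hAB hA hw hc
  obtain ⟨w₀, hw₀⟩ := hw
  have hyQ : ∀ j, y j ∈ Q j := fun j => (h1 j).2.mem (h1 j).1
  have hyinj : Function.Injective y := fun i j hij => h5 i j _ (hyQ i) (hij ▸ hyQ j)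
  refine Linked.of_restrict h1 h2 h4 h5 (ih _ ?_ _ _ _ _ rfl
    (h.restrict hk hM hAB hA hw₀ hc h2 h3 hyinj))
  -- Otherwise all 2k roots would lie in A ∩ B without v, which has fewer than 2k elements.
  obtain ⟨z, hz⟩ : ∃ z, z ∉ B := by
    by_contra! hall
    have hsub : Finset.univ.image x ⊆ (A ∩ B).erase v := by
      intro z hz
      obtain ⟨i, -, rfl⟩ := Finset.mem_image.1 hz
      exact Finset.mem_erase.2 ⟨hv i, Finset.mem_inter.2 ⟨hA i, hall _⟩⟩
    have := Finset.card_le_card hsub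
    rw [Finset.card_image_of_injective _ h.inj,
      Finset.card_erase_of_mem (Finset.mem_inter.2 ⟨hvA, hvB⟩)] at this
    simp at this
    omega
  rw [← hV]
  exact Fintype.card_subtype_lt (p := fun z => z ∈ (B : Set V)) (x := z) hz

end RootedLinked

/-! ### Dense graphs contain a large linked set. -/

section LinkedSet

/-- Any `k` disjoint pairs in `U` are joined by disjoint connected subsets of `U`. -/
def IsLinkedSet {V : Type*} (k : ℕ) (G : SimpleGraph V) (U : Set V) : Prop :=
  ∀ x : Fin k × Bool → V, Function.Injective x → (∀ i, x i ∈ U) →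
    ∃ C : Fin k → Set V, (∀ i, C i ⊆ U) ∧ (∀ i, x (i, false) ∈ C i ∧
      ReachIn G (C i) (x (i, false)) (x (i, true))) ∧ ∀ i j v, v ∈ C i → v ∈ C j → i = j

variable {k : ℕ}

theorem IsLinkedSet.of_induce {V : Type*} {G : SimpleGraph V} {A : Set V} {U : Set A}
    (h : IsLinkedSet k (G.induce A) U) : IsLinkedSet k G (Subtype.val '' U) := by
  intro x hx hxU
  choose y hyU hyx using hxU
  obtain ⟨C, h1, h2, h3⟩ := h y (fun i j hij => hx (by rw [← hyx, ← hyx, hij])) hyU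
  refine ⟨fun i => Subtype.val '' C i, fun i => Set.image_mono (h1 i), fun i => ?_, ?_⟩
  · rw [← hyx, ← hyx]
    exact ⟨⟨_, (h2 i).1, rfl⟩, (h2 i).2.of_induce⟩
  · rintro i j _ ⟨a, ha, rfl⟩ ⟨b, hb, hab⟩
    rw [Subtype.ext hab] at hb
    exact h3 i j a ha hb

theorem card_lt_of_linear {V : Type*} [Fintype V] (hk : 0 < k) (G : SimpleGraph V)
    (hn : 10 * k ≤ Fintype.card V)
    (hG : 24 * k * Fintype.card V ≤ (adjPairs G).card + 48 * k * k) :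
    10 * k < Fintype.card V := by
  by_contra hlt
  have hn1 : Fintype.card V = 10 * k := by omega
  have h := card_adjPairs_le_mul G
  rw [hn1] at h hG
  have : 10 * k * (10 * k - 1) ≤ 10 * k * (10 * k) := Nat.mul_le_mul_left _ (by omega)
  nlinarith

/-- Minimality forces degrees of at least 10k, so both sides are large enough for `hmin`. Adding the
two bounds leaves fewer than 24k(n + |A ∩ B|) - 96k² pairs, a contradiction if |A ∩ B| < 2k. This
calibrates the constant 48k² = 24k · 2k. -/
theorem le_card_inter_of_isSeparation {V : Type*} [Fintype V] [DecidableEq V] (hk : 0 < k)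
    {G : SimpleGraph V} (hn : 10 * k ≤ Fintype.card V)
    (hG : 24 * k * Fintype.card V ≤ (adjPairs G).card + 48 * k * k)
    (hmin : ∀ A : Finset V, A ≠ Finset.univ → 10 * k ≤ A.card →
      (adjPairs (G.induce (A : Set V))).card + 48 * k * k < 24 * k * A.card)
    {A B : Finset V} (hAB : IsSeparation G A B) {a b : V} (ha : a ∉ B) (hb : b ∉ A) :
    2 * k ≤ (A ∩ B).card := by
  have hlt := card_lt_of_linear hk G hn hG
  have hdeg : ∀ v, 10 * k ≤ (nbr G v).card := by
    intro v
    by_contra! hv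
    have h1 := card_adjPairs_le_delete G v
    have hA : Finset.univ.erase v ≠ Finset.univ := fun h => by
      have := Finset.mem_univ v
      rw [← h] at this
      simp at this
    have hcard : (Finset.univ.erase v).card + 1 = Fintype.card V := by
      rw [Finset.card_erase_of_mem (Finset.mem_univ v), Finset.card_univ]; omega
    have h2 := hmin _ hA (by omega)
    rw [card_adjPairs_induce] at h1 h2
    simp only [Finset.mem_coe, Finset.mem_erase, Finset.mem_univ, and_true,
      Set.mem_ofPred_eq] at h1 h2
    nlinarith
  have hA : 10 * k ≤ A.card := (hdeg a).trans <| Finset.card_le_card fun z hz =>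
    hAB.2 a z (by simpa using hz) ha
  have hB : 10 * k ≤ B.card := (hdeg b).trans <| Finset.card_le_card fun z hz =>
    hAB.mem_right_of_adj (by simpa using hz) hb
  have h1 := hmin A (fun h => hb (h ▸ Finset.mem_univ b)) hA
  have h2 := hmin B (fun h => ha (h ▸ Finset.mem_univ a)) hB
  rw [card_adjPairs_induce] at h1 h2
  have hcover : A ∪ B = Finset.univ := by
    ext v; simpa using hAB.1 v
  have h3 := Finset.card_union_add_card_inter A B
  rw [hcover, Finset.card_univ] at h3
  have h4 : (adjPairs G).card ≤
      ((adjPairs G).filter fun p => p.1 ∈ (A : Set V) ∧ p.2 ∈ (A : Set V)).card +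
      ((adjPairs G).filter fun p => p.1 ∈ (B : Set V) ∧ p.2 ∈ (B : Set V)).card := by
    refine le_trans (Finset.card_le_card ?_) (Finset.card_union_le _ _)
    rintro ⟨p, q⟩ hpq
    have hadj := mem_adjPairs.1 hpq
    simp only [Finset.mem_union, Finset.mem_filter, hpq, true_and, Finset.mem_coe]
    by_cases hpA : p ∈ A
    · by_cases hqA : q ∈ A
      · exact Or.inl ⟨hpA, hqA⟩
      · exact Or.inr ⟨hAB.mem_right_of_adj hadj.symm hqA, hAB.mem_of_notMem_left hqA⟩
    · exact Or.inr ⟨hAB.mem_of_notMem_left hpA, hAB.mem_right_of_adj hadj hpA⟩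
  by_contra! hlt
  nlinarith

/-- In a minimal induced subgraph satisfying the bound, small separations are excluded, so any 2k
roots make the dense minor rooted and the whole vertex set is linked. -/
theorem exists_isLinkedSet (hk : 0 < k) (n : ℕ) : ∀ (V : Type u) [Fintype V]
    (G : SimpleGraph V), Fintype.card V = n → 10 * k ≤ n →
    24 * k * n ≤ (adjPairs G).card + 48 * k * k →
    ∃ U : Set V, 10 * k ≤ U.ncard ∧ IsLinkedSet k G U := by
  classical
  induction n using Nat.strong_induction_on with
  | _ n ih =>
  intro V _ G hV hn hG
  by_cases hmin : ∀ A : Finset V, A ≠ Finset.univ → 10 * k ≤ A.card →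
      (adjPairs (G.induce (A : Set V))).card + 48 * k * k < 24 * k * A.card
  · refine ⟨Set.univ, by rwa [Set.ncard_univ, Nat.card_eq_fintype_card, hV], fun x hx _ => ?_⟩
    obtain ⟨W, _, _, M, f, hf, hM⟩ := hasDenseMinor_of_linear hk n V G hV hn hG
    have hR : IsRooted G x M f := by
      refine ⟨hf.nonempty, fun w => Or.inl (hf.conn w), fun w w' h _ => hf.adj w w' h, hx,
        fun A B hAB hA hw => ?_⟩
      obtain ⟨w, hw⟩ := hw
      obtain ⟨b, hb⟩ := hf.nonempty w
      by_cases hsub : ∀ a, a ∈ B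
      · have : Finset.univ.image x ⊆ A ∩ B := fun z hz => by
          obtain ⟨i, -, rfl⟩ := Finset.mem_image.1 hz
          exact Finset.mem_inter.2 ⟨hA i, hsub _⟩
        have := Finset.card_le_card this
        rw [Finset.card_image_of_injective _ hx] at this
        simp at this
        omega
      · push Not at hsub
        obtain ⟨a, ha⟩ := hsub
        exact le_card_inter_of_isSeparation hk (hV ▸ hn) (hV ▸ hG) hmin hAB ha (hw b hb)
    obtain ⟨C, h1, h2⟩ := hR.linked hk hM n V G x f hV
    exact ⟨C, fun i => Set.subset_univ _, h1, h2⟩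
  · push Not at hmin
    obtain ⟨A, hA, hAc, hAG⟩ := hmin
    have hlt : A.card < n := by
      rw [← hV, ← Finset.card_univ]
      exact Finset.card_lt_card (Finset.ssubset_univ_iff.2 hA)
    obtain ⟨U, hU, hL⟩ := ih _ hlt (A : Set V) (G.induce (A : Set V)) (by simp) hAc hAG
    refine ⟨Subtype.val '' U, ?_, hL.of_induce⟩
    rwa [Set.ncard_image_of_injective _ Subtype.val_injective]

end LinkedSet

/-! ### A dense bipartite subgraph and its linked set. -/

section Cut

variable {V : Type*}

/-- The edges of `G` joining the two sides. -/
def cutGraph (G : SimpleGraph V) (side : V → Bool) : SimpleGraph V where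
  Adj u v := G.Adj u v ∧ side u ≠ side v
  symm := ⟨fun _ _ h => ⟨h.1.symm, h.2.symm⟩⟩
  loopless := ⟨fun _ h => h.2 rfl⟩

theorem card_sides [Fintype V] [DecidableEq V] {u v : V} (huv : u ≠ v) :
    2 * ((Finset.univ : Finset (V → Bool)).filter fun s => s u ≠ s v).card =
      Fintype.card (V → Bool) := by
  have h1 := Finset.card_filter_add_card_filter_not
    (s := (Finset.univ : Finset (V → Bool))) (fun s => s u ≠ s v)
  have h2 : ((Finset.univ : Finset (V → Bool)).filter fun s => s u ≠ s v).card =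
      ((Finset.univ : Finset (V → Bool)).filter fun s => ¬ s u ≠ s v).card := by
    refine Finset.card_bij' (fun s _ => Function.update s u (!s u))
      (fun s _ => Function.update s u (!s u)) ?_ ?_ ?_ ?_
    all_goals intro s hs; simp [huv.symm] at hs ⊢
    · cases h : s u <;> cases h' : s v <;> simp_all
    · exact hs
  rw [Finset.card_univ] at h1
  omega

/-- Some bipartition cuts at least half of the edges. -/
theorem exists_cut [Fintype V] (G : SimpleGraph V) :
    ∃ side : V → Bool, (adjPairs G).card ≤ 2 * (adjPairs (cutGraph G side)).card := by
  classical
  -- Each edge is cut by exactly half of all bipartitions.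
  have hsum : ∑ s : V → Bool, (adjPairs G).card =
      ∑ s : V → Bool, 2 * (adjPairs (cutGraph G s)).card := by
    have h1 : ∀ s : V → Bool, (adjPairs (cutGraph G s)).card =
        ∑ p ∈ adjPairs G, if s p.1 ≠ s p.2 then 1 else 0 := by
      intro s
      rw [← Finset.card_filter]
      congr 1
      ext p
      simp [cutGraph]
    simp only [h1, Finset.mul_sum]
    rw [Finset.sum_comm, Finset.sum_const, Finset.card_univ, smul_eq_mul, mul_comm,
      ← smul_eq_mul, ← Finset.sum_const]
    refine Finset.sum_congr rfl fun p hp => ?_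
    rw [← Finset.mul_sum, ← Finset.card_filter, card_sides (mem_adjPairs.1 hp).ne]
  obtain ⟨s, -, hs⟩ := Finset.exists_le_of_sum_le Finset.univ_nonempty hsum.le
  exact ⟨s, hs⟩

theorem IsVertexConnected.le_card_nbr [Fintype V] {G : SimpleGraph V} {n : ℕ}
    (hG : IsVertexConnected G n) (v : V) : n ≤ (nbr G v).card := by
  classical
  by_contra! hlt
  have hconn := hG.2 _ hlt
  obtain ⟨w, hw⟩ : ∃ w, w ∉ insert v (nbr G v) := by
    by_contra! hall
    have h1 : (Finset.univ : Finset V) ⊆ insert v (nbr G v) := fun w _ => hall w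
    have h2 := (Finset.card_le_card h1).trans (Finset.card_insert_le _ _)
    rw [Finset.card_univ] at h2
    have := hG.1
    omega
  simp only [Finset.mem_insert, mem_nbr, not_or] at hw
  have hv : v ∈ ((nbr G v : Set V))ᶜ := by simp
  have hw' : w ∈ ((nbr G v : Set V))ᶜ := by simpa using hw.2
  obtain ⟨p⟩ := hconn.preconnected ⟨v, hv⟩ ⟨w, hw'⟩
  cases p with
  | nil => exact hw.1 rfl
  | @cons _ c _ h _ =>
    exact c.2 (by simpa using h)

/-- Degrees of at least 50k leave at least 25k|V| ordered pairs in the cut, above the required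
24k|V|. -/
theorem IsVertexConnected.exists_linked_cut [Fintype V] {G : SimpleGraph V} {k : ℕ} (hk : 0 < k)
    (hG : IsVertexConnected G (50 * k)) :
    ∃ (side : V → Bool) (U : Set V), 10 * k ≤ U.ncard ∧ IsLinkedSet k (cutGraph G side) U := by
  obtain ⟨side, hside⟩ := exists_cut G
  have h1 := hG.1
  have h2 : Fintype.card V * (50 * k) ≤ (adjPairs G).card := by
    rw [card_adjPairs, ← smul_eq_mul, ← Finset.card_univ]
    exact Finset.card_nsmul_le_sum _ _ _ fun v _ => hG.le_card_nbr v
  exact ⟨side, exists_isLinkedSet hk _ V (cutGraph G side) rfl (by omega) (by nlinarith)⟩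

end Cut

/-! ### Odd cycles from odd closed walks. -/

section OddCycle

open SimpleGraph

variable {V : Type*} {G : SimpleGraph V}

theorem exists_closed_subwalk {u v : V} (p : G.Walk u v) (hp : ¬ p.IsPath) :
    ∃ (x : V) (p₁ : G.Walk u x) (c : G.Walk x x) (p₂ : G.Walk x v),
      0 < c.length ∧ p.length = p₁.length + c.length + p₂.length := by
  classical
  induction p with
  | nil => exact absurd Walk.IsPath.nil hp
  | @cons a b _ h q ih =>
    by_cases hq : q.IsPath
    · have ha : a ∈ q.support := by
        by_contra ha
        exact hp (hq.cons ha)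
      refine ⟨a, .nil, .cons h (q.takeUntil a ha), q.dropUntil a ha, by simp, ?_⟩
      have := congrArg Walk.length (q.take_spec ha)
      rw [Walk.length_append] at this
      simp only [Walk.length_cons, Walk.length_nil]
      omega
    · obtain ⟨x, p₁, c, p₂, hc, hl⟩ := ih hq
      exact ⟨x, .cons h p₁, c, p₂, hc, by simp only [Walk.length_cons]; omega⟩

theorem length_eq_one_of_isPath {u v : V} (p : G.Walk u v) (hp : p.IsPath)
    (h : s(v, u) ∈ p.edges) : p.length = 1 := by
  cases p with
  | nil => simp at h
  | @cons _ b _ hadj q =>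
    rw [Walk.cons_isPath_iff] at hp
    rw [Walk.edges_cons, List.mem_cons] at h
    rcases h with h | h
    · have hb : b = v := by
        rcases Sym2.eq_iff.1 h with h | h
        · exact absurd h.2 hadj.ne
        · exact h.1.symm
      subst hb
      simp [(Walk.isPath_iff_nil.1 hp.1).length_eq_zero]
    · exact absurd (Walk.snd_mem_support_of_mem_edges _ h) hp.2

/-- An odd closed walk gives an odd cycle. -/
theorem exists_odd_cycle (n : ℕ) : ∀ (u : V) (w : G.Walk u u), w.length = n → Odd n →
    ∃ (v : V) (c : G.Walk v v), c.IsCycle ∧ Odd c.length := by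
  induction n using Nat.strong_induction_on with
  | _ n ih =>
  intro u w hw hn
  cases w with
  | nil => subst hw; simp at hn
  | @cons _ b _ h p =>
    rw [Walk.length_cons] at hw
    by_cases hp : p.IsPath
    · refine ⟨u, .cons h p, ?_, by rwa [Walk.length_cons, hw]⟩
      rw [Walk.cons_isCycle_iff]
      refine ⟨hp, fun he => ?_⟩
      rw [length_eq_one_of_isPath p hp he] at hw
      subst hw
      exact absurd hn (by decide)
    · obtain ⟨x, p₁, c, p₂, hc, hl⟩ := exists_closed_subwalk p hp
      -- Either c or the closed walk without c is odd, and both are shorter.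
      rcases Nat.even_or_odd c.length with he | ho
      · refine ih (p₁.append p₂ |>.cons h).length ?_ u _ rfl ?_
        · rw [Walk.length_cons, Walk.length_append]; omega
        · rw [Walk.length_cons, Walk.length_append]
          obtain ⟨r, hr⟩ := hn
          obtain ⟨s, hs⟩ := he
          exact ⟨r - s, by omega⟩
      · exact ih c.length (by omega) x c rfl ho

theorem exists_odd_cycle_of_not_isBipartite {S : Set V} (h : ¬ (G.induce S).IsBipartite) :
    ∃ (v : V) (c : G.Walk v v), (c.IsCycle ∧ Odd c.length) ∧ ∀ w ∈ c.support, w ∈ S := by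
  rw [SimpleGraph.IsBipartite, two_colorable_iff_forall_loop_even] at h
  push Not at h
  obtain ⟨u, w, hw⟩ := h
  obtain ⟨v, c, hc, ho⟩ := exists_odd_cycle _ u w rfl (Nat.not_even_iff_odd.1 hw)
  refine ⟨_, c.map (Embedding.induce S).toHom, ⟨hc.map Subtype.val_injective, by rwa [Walk.length_map]⟩,
    fun z hz => ?_⟩
  rw [Walk.support_map] at hz
  obtain ⟨y, -, rfl⟩ := List.mem_map.1 hz
  exact y.2

end OddCycle

/-! ### Parity of fixed points. -/

section Involution

variable {K : Type*} [DecidableEq K] {σ : K → K}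

theorem card_add_card_fixed_even (hσ : Function.Involutive σ) {s : Finset K}
    (hs : ∀ a ∈ s, σ a ∈ s) : Even (s.card + (s.filter fun a => σ a = a).card) := by
  have h1 : ∑ a ∈ s.filter (fun a => ¬ σ a = a), (1 : ZMod 2) = 0 := by
    refine Finset.sum_involution (fun a _ => σ a) (fun a _ => by decide) (fun a ha _ => ?_)
      (fun a ha => ?_) (fun a _ => hσ a)
    · exact (Finset.mem_filter.1 ha).2
    · rw [Finset.mem_filter] at ha ⊢
      exact ⟨hs a ha.1, fun h => ha.2 (hσ.injective h)⟩
  rw [Finset.sum_const, nsmul_one, ZMod.natCast_eq_zero_iff_even] at h1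
  have h2 := Finset.card_filter_add_card_filter_not (s := s) (fun a => σ a = a)
  rw [← h2]
  obtain ⟨r, hr⟩ := h1
  exact ⟨(s.filter fun a => σ a = a).card + r, by omega⟩

end Involution

/-! ### The Tutte–Berge formula, from Tutte's theorem. -/

section TutteBerge

variable {K : Type u}

/-- `L` together with `d` new vertices that are adjacent to everything. -/
def augment (L : SimpleGraph K) (d : ℕ) : SimpleGraph (K ⊕ Fin d) where
  Adj p q := p ≠ q ∧ ∀ a b, p = .inl a → q = .inl b → L.Adj a b
  symm := ⟨fun _ _ h => ⟨h.1.symm, fun a b ha hb => (h.2 b a hb ha).symm⟩⟩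
  loopless := ⟨fun _ h => h.1 rfl⟩

variable (L : SimpleGraph K) (d : ℕ)

theorem exists_involution_of_perfectMatching {M : (augment L d).Subgraph}
    (hM : M.IsPerfectMatching) :
    ∃ μ : K → K, Function.Involutive μ ∧ (∀ a, μ a = a ∨ L.Adj a (μ a)) ∧
      {a | μ a = a}.ncard ≤ d := by
  classical
  choose m hm hmu using fun v => hM.1 (hM.2 v)
  have hmm : ∀ v, m (m v) = v := fun v => (hmu _ _ (hm v).symm).symm
  set μ : K → K := fun a => Sum.elim id (fun _ => a) (m (.inl a)) with hμ
  have hinl : ∀ a b, m (.inl a) = .inl b → μ a = b := fun a b h => by simp [hμ, h]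
  have hinr : ∀ a j, m (.inl a) = .inr j → μ a = a := fun a j h => by simp [hμ, h]
  have hadj : ∀ a b, m (.inl a) = .inl b → L.Adj a b := fun a b h =>
    (M.adj_sub (hm (.inl a))).2 a b rfl h
  refine ⟨μ, fun a => ?_, fun a => ?_, ?_⟩
  · rcases h : m (.inl a) with b | j
    · rw [hinl a b h]
      exact hinl b a (by rw [← h, hmm])
    · rw [hinr a j h, hinr a j h]
  · rcases h : m (.inl a) with b | j
    · rw [hinl a b h]; exact Or.inr (hadj a b h)
    · exact Or.inl (hinr a j h)
  · have hfix : ∀ a ∈ {a | μ a = a}, m (.inl a) ∈ Set.range (Sum.inr : Fin d → K ⊕ Fin d) := by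
      intro a ha
      rcases h : m (.inl a) with b | j
      · have := hadj a b h
        rw [← hinl a b h, ha] at this
        exact absurd rfl this.ne
      · exact ⟨j, rfl⟩
    have := Set.ncard_le_ncard_of_injOn (s := {a | μ a = a}) (fun a => m (.inl a)) hfix
      (fun a _ b _ hab => Sum.inl_injective (by
        have hab : m (.inl a) = m (.inl b) := hab
        rw [← hmm (.inl a), hab, hmm])) (Set.toFinite _)
    refine this.trans ?_
    rw [← Set.image_univ, Set.ncard_image_of_injective _ Sum.inr_injective, Set.ncard_univ]
    simp

variable [Fintype K]

/-- A new vertex outside u would connect everything that is left, so that u is empty and the total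
is odd, against `hpar`. Hence u contains all d new vertices. Parity raises the excess of odd
components from 1 to 2. -/
theorem exists_labels_of_isTutteViolator (hpar : Even (Fintype.card K + d))
    {u : Set (K ⊕ Fin d)} (hu : (augment L d).IsTutteViolator u) :
    ∃ (S : Set K) (γ : Type u) (c : K → γ) (O : Set γ),
      (∀ a b, a ∉ S → b ∉ S → L.Adj a b → c a = c b) ∧
      (∀ o ∈ O, Odd {a | a ∉ S ∧ c a = o}.ncard) ∧ S.ncard + d + 2 ≤ O.ncard := by
  classical
  unfold SimpleGraph.IsTutteViolator at hu
  set H := ((⊤ : (augment L d).Subgraph).deleteVerts u).coe with hH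
  have hmem : ∀ v, v ∈ ((⊤ : (augment L d).Subgraph).deleteVerts u).verts ↔ v ∉ u := by simp
  have hHadj : ∀ v w, H.Adj v w ↔ (augment L d).Adj v.1 w.1 := by
    intro v w
    have h1 := (hmem _).1 v.2
    have h2 := (hmem _).1 w.2
    simp [hH, h1, h2]
  have hcardH : Nat.card ((⊤ : (augment L d).Subgraph).deleteVerts u).verts + u.ncard =
      Fintype.card K + d := by
    have h1 : ((⊤ : (augment L d).Subgraph).deleteVerts u).verts = uᶜ := by
      ext v; simp
    rw [h1, Nat.card_coe_set_eq, add_comm, Set.ncard_add_ncard_compl]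
    simp [Nat.card_eq_fintype_card]
  have hodd := SimpleGraph.odd_ncard_oddComponents (G := H)
  by_cases hj : ∃ j, Sum.inr j ∉ u
  · exfalso
    obtain ⟨j, hj⟩ := hj
    have hsub : ∀ C : H.ConnectedComponent, C = H.connectedComponentMk ⟨.inr j, (hmem _).2 hj⟩ := by
      intro C
      induction C using SimpleGraph.ConnectedComponent.ind with
      | _ v =>
      rw [SimpleGraph.ConnectedComponent.eq]
      by_cases hv : v = ⟨.inr j, (hmem _).2 hj⟩
      · rw [hv]
      · refine SimpleGraph.Adj.reachable ((hHadj _ _).2 ⟨fun h => hv (Subtype.ext h), ?_⟩)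
        intro a b _ hb
        simp at hb
    have hle : H.oddComponents.ncard ≤ 1 :=
      (Set.ncard_le_one_iff (Set.toFinite _)).2 fun {C C'} _ _ => (hsub C).trans (hsub C').symm
    have h0 : u.ncard = 0 := by omega
    have h1 : H.oddComponents.ncard = 1 := by omega
    rw [h1] at hodd
    have := hodd.1 odd_one
    rw [h0, add_zero] at hcardH
    rw [hcardH] at this
    exact absurd hpar (Nat.not_even_iff_odd.2 this)
  push Not at hj
  set S : Set K := {a | Sum.inl a ∈ u} with hS
  have huc : u.ncard = S.ncard + d := by
    have : u = Sum.inl '' S ∪ Set.range Sum.inr := by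
      ext (a | j)
      · simp [hS]
      · simpa using hj j
    rw [this, Set.ncard_union_eq, Set.ncard_image_of_injective _ Sum.inl_injective,
      ← Set.image_univ, Set.ncard_image_of_injective _ Sum.inr_injective, Set.ncard_univ]
    · simp
    · rw [Set.disjoint_left]
      rintro _ ⟨a, -, rfl⟩ ⟨j, hj⟩
      simp at hj
  set c : K → Option H.ConnectedComponent := fun a =>
    if h : Sum.inl a ∈ u then none else some (H.connectedComponentMk ⟨.inl a, (hmem _).2 h⟩) with hc
  have hcS : ∀ a (h : a ∉ S), c a = some (H.connectedComponentMk ⟨.inl a, (hmem _).2 h⟩) :=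
    fun a h => by
      have h : Sum.inl a ∉ u := h
      simp [hc, h]
  refine ⟨S, _, c, some '' H.oddComponents, fun a b ha hb hab => ?_, ?_, ?_⟩
  · rw [hcS a ha, hcS b hb]
    congr 1
    rw [SimpleGraph.ConnectedComponent.eq]
    refine SimpleGraph.Adj.reachable ((hHadj _ _).2 ⟨fun h => hab.ne (Sum.inl_injective h), ?_⟩)
    intro a' b' ha' hb'
    rwa [← Sum.inl_injective ha', ← Sum.inl_injective hb']
  · rintro _ ⟨C, hC, rfl⟩
    have hC : Odd C.supp.ncard := hC
    have : (fun v : ((⊤ : (augment L d).Subgraph).deleteVerts u).verts => v.1) '' C.supp =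
        Sum.inl '' {a | a ∉ S ∧ c a = some C} := by
      ext (a | j)
      · constructor
        · rintro ⟨v, hv, hva⟩
          obtain ⟨v, hvm⟩ := v
          obtain rfl : v = Sum.inl a := hva
          have haS : a ∉ S := (hmem _).1 hvm
          exact ⟨a, ⟨haS, by rw [hcS a haS]; congr 1⟩, rfl⟩
        · rintro ⟨b, ⟨hbS, hb⟩, hba⟩
          obtain rfl := Sum.inl_injective hba
          rw [hcS b hbS] at hb
          exact ⟨⟨.inl b, (hmem _).2 hbS⟩, Option.some.inj hb, rfl⟩
      · constructor
        · rintro ⟨v, -, hv⟩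
          exact absurd (hj j) (hv ▸ (hmem _).1 v.2)
        · rintro ⟨b, -, hb⟩
          simp at hb
    rwa [← Set.ncard_image_of_injective _ Sum.inl_injective, ← this,
      Set.ncard_image_of_injective _ Subtype.val_injective]
  · rw [Set.ncard_image_of_injective _ (Option.some_injective _)]
    by_contra hlt
    have h1 : H.oddComponents.ncard = u.ncard + 1 := by omega
    rw [h1] at hodd
    rw [← hcardH] at hpar
    rcases Nat.even_or_odd u.ncard with he | ho
    · have h2 := hodd.1 he.add_one
      exact absurd hpar (Nat.not_even_iff_odd.2 (h2.add_even he))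
    · have h2 : ¬ Odd (u.ncard + 1) := Nat.not_odd_iff_even.2 ho.add_one
      rw [hodd, Nat.not_odd_iff_even] at h2
      exact absurd hpar (Nat.not_even_iff_odd.2 (h2.add_odd ho))

/-- The **Tutte–Berge formula**: a matching missing at most `d` vertices, or a set whose deletion
leaves too many odd parts. -/
theorem tutte_berge (hpar : Even (Fintype.card K + d)) :
    (∃ μ : K → K, Function.Involutive μ ∧ (∀ a, μ a = a ∨ L.Adj a (μ a)) ∧
      {a | μ a = a}.ncard ≤ d) ∨
    ∃ (S : Set K) (γ : Type u) (c : K → γ) (O : Set γ),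
      (∀ a b, a ∉ S → b ∉ S → L.Adj a b → c a = c b) ∧
      (∀ o ∈ O, Odd {a | a ∉ S ∧ c a = o}.ncard) ∧ S.ncard + d + 2 ≤ O.ncard := by
  by_cases hT : ∃ M : (augment L d).Subgraph, M.IsPerfectMatching
  · obtain ⟨M, hM⟩ := hT
    exact Or.inl (exists_involution_of_perfectMatching L d hM)
  · rw [SimpleGraph.tutte] at hT
    push Not at hT
    obtain ⟨u, hu⟩ := hT
    exact Or.inr (exists_labels_of_isTutteViolator L d hpar hu)

end TutteBerge

/-! ### Components of the union of two matchings. -/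

section TwoInvolutions

variable {K : Type*} {μ σ : K → K}

/-- The graph joining every element to its images under two involutions. -/
def pairGraph (μ σ : K → K) (hμ : Function.Involutive μ) (hσ : Function.Involutive σ) :
    SimpleGraph K where
  Adj a b := a ≠ b ∧ (b = μ a ∨ b = σ a)
  symm := ⟨fun a b h => ⟨h.1.symm, h.2.imp (fun e => by rw [e, hμ]) fun e => by rw [e, hσ]⟩⟩
  loopless := ⟨fun _ h => h.1 rfl⟩

variable (hμ : Function.Involutive μ) (hσ : Function.Involutive σ)

theorem connectedComponentMk_left (a : K) :
    (pairGraph μ σ hμ hσ).connectedComponentMk (μ a) =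
      (pairGraph μ σ hμ hσ).connectedComponentMk a := by
  by_cases h : μ a = a
  · rw [h]
  · exact SimpleGraph.ConnectedComponent.eq.2
      (SimpleGraph.Adj.reachable (G := pairGraph μ σ hμ hσ) ⟨h, Or.inl (hμ a).symm⟩)

theorem connectedComponentMk_right (a : K) :
    (pairGraph μ σ hμ hσ).connectedComponentMk (σ a) =
      (pairGraph μ σ hμ hσ).connectedComponentMk a := by
  by_cases h : σ a = a
  · rw [h]
  · exact SimpleGraph.ConnectedComponent.eq.2
      (SimpleGraph.Adj.reachable (G := pairGraph μ σ hμ hσ) ⟨h, Or.inr (hσ a).symm⟩)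

open Classical in
/-- A component of the graph of two involutions is a path or a cycle, so it contains at most two
fixed points. -/
theorem card_fixed_le_two [Fintype K] (C : (pairGraph μ σ hμ hσ).ConnectedComponent) :
    (C.supp.toFinset.filter fun a => μ a = a).card +
      (C.supp.toFinset.filter fun a => σ a = a).card ≤ 2 := by
  set H : SimpleGraph C.supp := (pairGraph μ σ hμ hσ).induce C.supp with hH
  have hc : H.Connected := C.connected_toSimpleGraph
  -- A connected graph has at least |C| - 1 edges, and each fixed point of either map lowers a
  -- degree bound of 2 by one. Comparing degree sums leaves room for two fixed points.
  have h1 := hc.card_vert_le_card_edgeSet_add_one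
  have h2 : ∑ v, (nbr H v).card = 2 * Nat.card H.edgeSet := by
    rw [Nat.card_eq_fintype_card, ← SimpleGraph.edgeFinset_card,
      ← SimpleGraph.sum_degrees_eq_twice_card_edges]
    refine Finset.sum_congr rfl fun v _ => ?_
    rw [← SimpleGraph.card_neighborFinset_eq_degree]
    congr 1
    ext w
    simp
  have h3 : ∀ v : C.supp, (nbr H v).card + (if μ v.1 = v.1 then 1 else 0) +
      (if σ v.1 = v.1 then 1 else 0) ≤ 2 := by
    intro v
    have hsub : (nbr H v).image Subtype.val ⊆ ({μ v.1, σ v.1} : Finset K).erase v.1 := by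
      intro w hw
      obtain ⟨w, hw', rfl⟩ := Finset.mem_image.1 hw
      have hadj : (pairGraph μ σ hμ hσ).Adj v.1 w.1 := (mem_nbr.1 hw' : H.Adj v w)
      refine Finset.mem_erase.2 ⟨hadj.1.symm, ?_⟩
      simpa using hadj.2
    have h4 := Finset.card_le_card hsub
    rw [Finset.card_image_of_injective _ Subtype.val_injective] at h4
    have h5 : (({μ v.1, σ v.1} : Finset K).erase v.1).card ≤ 2 :=
      (Finset.card_le_card (Finset.erase_subset _ _)).trans Finset.card_le_two
    by_cases hm : μ v.1 = v.1 <;> by_cases hs : σ v.1 = v.1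
    · rw [hm, hs] at h4; simp at h4; simp [hm, hs, h4]
    · have : ({μ v.1, σ v.1} : Finset K).erase v.1 ⊆ {σ v.1} := by
        intro w hw
        simp only [hm, Finset.mem_erase, Finset.mem_insert, Finset.mem_singleton] at hw ⊢
        tauto
      have h6 := h4.trans (Finset.card_le_card this)
      rw [Finset.card_singleton] at h6
      simp [hm, hs]; omega
    · have : ({μ v.1, σ v.1} : Finset K).erase v.1 ⊆ {μ v.1} := by
        intro w hw
        simp only [hs, Finset.mem_erase, Finset.mem_insert, Finset.mem_singleton] at hw ⊢
        tauto
      have h6 := h4.trans (Finset.card_le_card this)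
      rw [Finset.card_singleton] at h6
      simp [hm, hs]; omega
    · simp [hm, hs]; omega
  have h6 := Finset.sum_le_sum fun v (_ : v ∈ Finset.univ) => h3 v
  rw [Finset.sum_add_distrib, Finset.sum_add_distrib, h2, Finset.sum_const, Finset.card_univ,
    smul_eq_mul] at h6
  have h7 : ∀ τ : K → K, (C.supp.toFinset.filter fun a => τ a = a).card =
      ∑ v : C.supp, if τ v.1 = v.1 then 1 else 0 := by
    intro τ
    rw [Finset.card_filter, ← Finset.sum_coe_sort]
    refine Fintype.sum_equiv (Equiv.subtypeEquivRight fun v => by simp) _ _ fun v => rfl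
  rw [h7, h7]
  have h8 : Nat.card ↥C.supp = Fintype.card ↥C.supp := Nat.card_eq_fintype_card
  omega

open Classical in
/-- If `μ` has `2 * k` fixed points fewer than `σ`, there are at least `k` components with two fixed
points of `σ` and none of `μ`. -/
theorem le_card_good [Fintype K] {k : ℕ}
    (hk : (Finset.univ.filter fun a => μ a = a).card + 2 * k ≤
      (Finset.univ.filter fun a => σ a = a).card) :
    k ≤ (Finset.univ.filter fun C : (pairGraph μ σ hμ hσ).ConnectedComponent =>
      (C.supp.toFinset.filter fun a => σ a = a).card = 2 ∧
      (C.supp.toFinset.filter fun a => μ a = a).card = 0).card := by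
  set D := pairGraph μ σ hμ hσ with hD
  have hsum : ∀ τ : K → K, (Finset.univ.filter fun a => τ a = a).card =
      ∑ C : D.ConnectedComponent, (C.supp.toFinset.filter fun a => τ a = a).card := by
    intro τ
    rw [Finset.card_eq_sum_card_fiberwise (f := D.connectedComponentMk) (t := Finset.univ)
      fun _ _ => Finset.mem_coe.2 (Finset.mem_univ _)]
    refine Finset.sum_congr rfl fun C _ => congrArg _ ?_
    ext a
    simp [and_comm]
  -- Both counts have the parity of |C| and their sum is at most 2, so `σ` can exceed `μ` only with
  -- 2 against 0.
  have hpt : ∀ C : D.ConnectedComponent, (C.supp.toFinset.filter fun a => σ a = a).card ≤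
      (C.supp.toFinset.filter fun a => μ a = a).card +
      2 * (if (C.supp.toFinset.filter fun a => σ a = a).card = 2 ∧
        (C.supp.toFinset.filter fun a => μ a = a).card = 0 then 1 else 0) := by
    intro C
    have h1 := card_fixed_le_two hμ hσ C
    have h2 := card_add_card_fixed_even hμ (s := C.supp.toFinset) fun a ha => by
      simp only [Set.mem_toFinset, SimpleGraph.ConnectedComponent.mem_supp_iff] at ha ⊢
      rw [← ha]; exact connectedComponentMk_left hμ hσ a
    have h3 := card_add_card_fixed_even hσ (s := C.supp.toFinset) fun a ha => by
      simp only [Set.mem_toFinset, SimpleGraph.ConnectedComponent.mem_supp_iff] at ha ⊢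
      rw [← ha]; exact connectedComponentMk_right hμ hσ a
    rw [Nat.even_iff] at h2 h3
    split_ifs with hg
    · omega
    · omega
  have h := Finset.sum_le_sum fun C (_ : C ∈ Finset.univ) => hpt C
  rw [Finset.sum_add_distrib, ← hsum, ← hsum, ← Finset.mul_sum, ← Finset.card_filter] at h
  omega

open Classical in
/-- If `μ` has `2 * k` fixed points fewer than `σ`, there are `k` disjoint sets that are closed under
both and contain exactly two fixed points of `σ` and none of `μ`. -/
theorem exists_disjoint_parts [Fintype K] (hμ : Function.Involutive μ)
    (hσ : Function.Involutive σ) {k : ℕ}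
    (hk : (Finset.univ.filter fun a => μ a = a).card + 2 * k ≤
      (Finset.univ.filter fun a => σ a = a).card) :
    ∃ (s : Fin k → Finset K) (a b : Fin k → K), (∀ i j c, c ∈ s i → c ∈ s j → i = j) ∧
      ∀ i, (∀ c ∈ s i, μ c ∈ s i) ∧ (∀ c ∈ s i, σ c ∈ s i) ∧ (∀ c ∈ s i, μ c ≠ c) ∧ a i ≠ b i ∧
        ∀ c, c ∈ s i ∧ σ c = c ↔ c = a i ∨ c = b i := by
  obtain ⟨T, hT, hTc⟩ := Finset.exists_subset_card_eq (le_card_good hμ hσ hk)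
  let e := T.equivFinOfCardEq hTc
  have hgood := fun i => (Finset.mem_filter.1 (hT (e.symm i).2)).2
  choose a b hab hsab using fun i => Finset.card_eq_two.1 (hgood i).1
  have hmem : ∀ i c, c ∈ (e.symm i).1.supp.toFinset ↔
      (pairGraph μ σ hμ hσ).connectedComponentMk c = (e.symm i).1 := by simp
  refine ⟨fun i => (e.symm i).1.supp.toFinset, a, b, fun i j c hi hj => ?_,
    fun i => ⟨fun c hc => ?_, fun c hc => ?_, fun c hc h => ?_, hab i, fun c => ?_⟩⟩
  · rw [hmem] at hi hj
    exact e.symm.injective (Subtype.ext (hi.symm.trans hj))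
  · rw [hmem] at hc ⊢
    rw [connectedComponentMk_left, hc]
  · rw [hmem] at hc ⊢
    rw [connectedComponentMk_right, hc]
  · have h0 := Finset.card_eq_zero.1 (hgood i).2
    exact Finset.notMem_empty c (h0 ▸ Finset.mem_filter.2 ⟨hc, h⟩)
  · have h := Finset.ext_iff.1 (hsab i) c
    rwa [Finset.mem_filter, Finset.mem_insert, Finset.mem_singleton] at h

end TwoInvolutions

/-! ### The double graph and its swap involution. -/

section Double

variable {V : Type u} {G : SimpleGraph V} {U : Set V} {side : V → Bool}

/-- Two copies of every vertex outside `U`, one copy of every vertex in `U`. -/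
abbrev Copy (U : Set V) (side : V → Bool) : Type u :=
  {a : V × Bool // a.1 ∈ U → a.2 = side a.1}

/-- Two copies of `G`, each retaining one side of `U`, with the copies of a vertex joined. Paths
between copies of vertices in `U` correspond to paths of `G` that violate the bipartition. -/
def doubleGraph (G : SimpleGraph V) (U : Set V) (side : V → Bool) :
    SimpleGraph (Copy U side) where
  Adj a b := (a.1.2 = b.1.2 ∧ G.Adj a.1.1 b.1.1) ∨ (a.1.1 = b.1.1 ∧ a.1.2 ≠ b.1.2)
  symm := ⟨fun _ _ h => h.imp (fun h => ⟨h.1.symm, h.2.symm⟩) fun h => ⟨h.1.symm, h.2.symm⟩⟩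
  loopless := ⟨fun _ h => h.elim (fun h => h.2.ne rfl) fun h => h.2 rfl⟩

open Classical in
/-- Exchange the copies of the vertices outside `U`. -/
noncomputable def swap (a : Copy U side) : Copy U side :=
  if h : a.1.1 ∈ U then a else ⟨(a.1.1, !a.1.2), fun h' => absurd h' h⟩

theorem swap_eq_self_iff {a : Copy U side} : swap a = a ↔ a.1.1 ∈ U := by
  by_cases h : a.1.1 ∈ U
  · simp [swap, h]
  · simp only [swap, h, dif_neg, not_false_eq_true, iff_false]
    intro he
    have := congrArg (fun b : Copy U side => b.1.2) he
    simp at this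

theorem swap_fst (a : Copy U side) : (swap a).1.1 = a.1.1 := by
  by_cases h : a.1.1 ∈ U <;> simp [swap, h]

theorem swap_snd {a : Copy U side} (h : swap a ≠ a) : (swap a).1.2 = !a.1.2 := by
  rw [Ne, swap_eq_self_iff] at h
  simp [swap, h]

theorem swap_involutive : Function.Involutive (swap : Copy U side → Copy U side) := by
  intro a
  by_cases h : a.1.1 ∈ U <;> simp [swap, h]

theorem doubleGraph_adj_swap {a : Copy U side} (h : swap a ≠ a) :
    (doubleGraph G U side).Adj a (swap a) :=
  Or.inr ⟨(swap_fst a).symm, by rw [swap_snd h]; cases a.1.2 <;> simp⟩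

theorem eq_or_eq_swap {a b : Copy U side} (h : b.1.1 = a.1.1) :
    b = a ∨ (b = swap a ∧ swap a ≠ a) := by
  by_cases h2 : b.1.2 = a.1.2
  · exact Or.inl (Subtype.ext (Prod.ext h h2))
  · have hs : swap a ≠ a := by
      rw [Ne, swap_eq_self_iff]
      intro hU
      exact h2 ((b.2 (h ▸ hU)).trans (by rw [h]; exact (a.2 hU).symm))
    refine Or.inr ⟨Subtype.ext (Prod.ext (h.trans (swap_fst a).symm) ?_), hs⟩
    rw [swap_snd hs]
    exact (Bool.not_eq.2 (Ne.symm h2)).symm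

variable [Fintype V]

open Classical in
theorem card_fixed_swap :
    ((Finset.univ : Finset (Copy U side)).filter fun a => swap a = a).card = U.ncard := by
  rw [Set.ncard_eq_toFinset_card']
  refine Finset.card_bij (fun a _ => a.1.1) (fun a ha => ?_) (fun a ha b hb hab => ?_)
    fun v hv => ?_
  · simpa [swap_eq_self_iff] using ha
  · rcases eq_or_eq_swap hab with h | ⟨h, h'⟩
    · exact h
    · exact absurd (Finset.mem_filter.1 hb).2 h'
  · refine ⟨⟨(v, side v), fun _ => rfl⟩, ?_, rfl⟩
    simpa [swap_eq_self_iff] using hv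

open Classical in
theorem even_card_copy {k : ℕ} (hU : 2 * k ≤ U.ncard) :
    Even (Fintype.card (Copy U side) + (U.ncard - 2 * k)) := by
  have h := card_add_card_fixed_even (swap_involutive (U := U) (side := side))
    (s := Finset.univ) fun _ _ => Finset.mem_univ _
  rw [card_fixed_swap, Finset.card_univ] at h
  rw [Nat.even_iff] at h ⊢
  omega

end Double

/-! ### From a Tutte–Berge obstruction to a bipartite remainder. -/

section Deletion

variable {V : Type u} [Fintype V] {G : SimpleGraph V} {U : Set V} {side : V → Bool}
  {S : Set (Copy U side)} {γ : Type u} {c : Copy U side → γ}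

/-- Otherwise `swap`, which moves along edges and so preserves labels off S, would pair off the
elements labelled `o`, making their number even. -/
theorem exists_boundary (hc : ∀ a b, a ∉ S → b ∉ S → (doubleGraph G U side).Adj a b → c a = c b)
    {o : γ} (ho : Odd {a | a ∉ S ∧ c a = o}.ncard) :
    ∃ a, a ∉ S ∧ (swap a = a ∨ swap a ∈ S) ∧ c a = o := by
  classical
  by_contra! hno
  have h1 := card_add_card_fixed_even (swap_involutive (U := U) (side := side))
    (s := Finset.univ.filter fun a => a ∉ S ∧ c a = o) fun a ha => by
      simp only [Finset.mem_filter, Finset.mem_univ, true_and] at ha ⊢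
      have hsS : swap a ∉ S := fun h => hno a ha.1 (Or.inr h) ha.2
      have hne : swap a ≠ a := fun h => hno a ha.1 (Or.inl h) ha.2
      exact ⟨hsS, by rw [← hc a (swap a) ha.1 hsS (doubleGraph_adj_swap hne), ha.2]⟩
  have h2 : ((Finset.univ.filter fun a => a ∉ S ∧ c a = o).filter fun a => swap a = a) = ∅ := by
    rw [Finset.filter_eq_empty_iff]
    intro a ha h
    have ha := (Finset.mem_filter.1 ha).2
    exact hno a ha.1 (Or.inl h) ha.2
  rw [h2, Finset.card_empty, add_zero] at h1
  rw [Set.ncard_eq_toFinset_card', Set.toFinset_ofPred] at ho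
  exact absurd h1 (Nat.not_even_iff_odd.2 ho)

open Classical in
/-- A Tutte–Berge obstruction in the double graph gives a set of vertices outside of which every
label has at most one lone copy. -/
theorem exists_deletion (hU : U.Nonempty)
    (hc : ∀ a b, a ∉ S → b ∉ S → (doubleGraph G U side).Adj a b → c a = c b) {O : Set γ}
    (hodd : ∀ o ∈ O, Odd {a | a ∉ S ∧ c a = o}.ncard) :
    ∃ X : Finset V, X.card + O.ncard ≤ S.ncard + U.ncard ∧
      (∀ a : Copy U side, a.1.1 ∉ X → a ∈ S → swap a ∉ S) ∧
      ∀ a b : Copy U side, a.1.1 ∉ X → b.1.1 ∉ X → a ∉ S → b ∉ S →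
        (swap a = a ∨ swap a ∈ S) → (swap b = b ∨ swap b ∈ S) → c a = c b → a = b := by
  obtain ⟨v₀, hv₀⟩ := hU
  have : Nonempty (Copy U side) := ⟨⟨(v₀, side v₀), fun _ => rfl⟩⟩
  set Dd : Finset (Copy U side) := Finset.univ.filter fun a => a ∈ S ∧ swap a ∈ S with hDd
  set Bd : Finset (Copy U side) := Finset.univ.filter fun a =>
    a ∉ S ∧ (swap a = a ∨ swap a ∈ S) with hBd
  -- A lone copy belongs to a vertex of U or is the partner of an element of S that `Dd` does not
  -- count.
  have hcount : Dd.card + Bd.card ≤ S.ncard + U.ncard := by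
    set E : Finset (Copy U side) := Finset.univ.filter fun a => a ∈ S ∧ swap a ∉ S with hE
    set E' : Finset (Copy U side) := Finset.univ.filter fun a => a ∉ S ∧ swap a ∈ S with hE'
    have h1 : Bd ⊆ (Finset.univ.filter fun a : Copy U side => swap a = a) ∪ E' := by
      intro a ha
      simp only [hBd, hE', Finset.mem_union, Finset.mem_filter, Finset.mem_univ, true_and] at ha ⊢
      tauto
    have h2 := (Finset.card_le_card h1).trans (Finset.card_union_le _ _)
    rw [card_fixed_swap] at h2
    have h3 : E'.card ≤ E.card := by
      refine Finset.card_le_card_of_injOn swap (fun a ha => ?_) (swap_involutive.injective.injOn)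
      simp only [hE, hE', Finset.coe_filter, Finset.mem_univ, true_and, Set.mem_ofPred_eq] at ha ⊢
      exact ⟨ha.2, by rw [swap_involutive]; exact ha.1⟩
    have h4 : Dd.card + E.card = S.ncard := by
      rw [Set.ncard_eq_toFinset_card',
        ← Finset.card_filter_add_card_filter_not (s := S.toFinset) fun a => swap a ∈ S]
      congr 2 <;> ext a <;> simp [hDd, hE]
    omega
  choose! g hg using fun (o : γ) (ho : o ∈ Bd.image c) => Finset.mem_image.1 ho
  -- R spares one lone copy for each label that has one. By `exists_boundary` every label in `O` has
  -- one, so at least |O| lone copies are spared.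
  set R := (Bd.image c).image g with hR
  have hRc : R.card = (Bd.image c).card := Finset.card_image_of_injOn fun o ho o' ho' h => by
    rw [← (hg o ho).2, h, (hg o' ho').2]
  have hRB : R ⊆ Bd := fun a ha => by
    obtain ⟨o, ho, rfl⟩ := Finset.mem_image.1 ha
    exact (hg o ho).1
  have hOc : O.ncard ≤ (Bd.image c).card := by
    rw [← Set.ncard_coe_finset]
    refine Set.ncard_le_ncard (fun o ho => ?_) (Set.toFinite _)
    obtain ⟨a, h1, h2, h3⟩ := exists_boundary hc (hodd o ho)
    exact Finset.mem_coe.2 (Finset.mem_image.2 ⟨a, Finset.mem_filter.2 ⟨Finset.mem_univ _, h1, h2⟩, h3⟩)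
  refine ⟨(Dd ∪ (Bd \ R)).image fun a => a.1.1, ?_, fun a ha haS hs => ?_,
    fun a b ha hb haS hbS ha' hb' hab => ?_⟩
  · have h1 := (Finset.card_image_le (s := Dd ∪ (Bd \ R)) (f := fun a => a.1.1)).trans
      (Finset.card_union_le _ _)
    have h2 := Finset.card_sdiff_of_subset hRB
    have h3 := Finset.card_le_card hRB
    omega
  · exact ha (Finset.mem_image.2 ⟨a, Finset.mem_union_left _
      (Finset.mem_filter.2 ⟨Finset.mem_univ _, haS, hs⟩), rfl⟩)
  · have key : ∀ a : Copy U side, a.1.1 ∉ (Dd ∪ (Bd \ R)).image (fun a => a.1.1) → a ∉ S →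
        (swap a = a ∨ swap a ∈ S) → g (c a) = a := by
      intro a ha haS ha'
      have haB : a ∈ Bd := Finset.mem_filter.2 ⟨Finset.mem_univ _, haS, ha'⟩
      have haR : a ∈ R := by
        by_contra h
        exact ha (Finset.mem_image.2 ⟨a, Finset.mem_union_right _ (Finset.mem_sdiff.2 ⟨haB, h⟩), rfl⟩)
      obtain ⟨o, ho, rfl⟩ := Finset.mem_image.1 haR
      rw [(hg o ho).2]
    rw [← key a ha haS ha', hab, key b hb hbS hb']

/-- In a highly connected graph, the rest of the graph after such a deletion is bipartite. -/
theorem isBipartite_of_labels {n : ℕ} (hG : IsVertexConnected G n) {X : Finset V}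
    (hXn : X.card + 1 < n) (hXU : X.card + 1 < U.ncard)
    (hc : ∀ a b, a ∉ S → b ∉ S → (doubleGraph G U side).Adj a b → c a = c b)
    (hX1 : ∀ a : Copy U side, a.1.1 ∉ X → a ∈ S → swap a ∉ S)
    (hX2 : ∀ a b : Copy U side, a.1.1 ∉ X → b.1.1 ∉ X → a ∉ S → b ∉ S →
      (swap a = a ∨ swap a ∈ S) → (swap b = b ∨ swap b ∈ S) → c a = c b → a = b) :
    (G.induce ((X : Set V)ᶜ)).IsBipartite := by
  classical
  have hcopy : ∀ v, ∃ a : Copy U side, a.1.1 = v ∧ (v ∉ X → a ∉ S) := by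
    intro v
    by_cases h : (⟨(v, side v), fun _ => rfl⟩ : Copy U side) ∈ S
    · exact ⟨_, swap_fst _, fun hv => hX1 _ hv h⟩
    · exact ⟨_, rfl, fun _ => h⟩
  choose α hα hαS using hcopy
  -- If both copies of p avoid S, they share a label o. A neighbour outside X then has a copy
  -- labelled o, and again two copies off S unless it is the only vertex allowed in R. Connectivity
  -- of G - (X ∪ R) carries this to a vertex of U, which has a single copy.
  have hlone : ∀ v, v ∉ X → swap (α v) = α v ∨ swap (α v) ∈ S := by
    intro p hp
    by_contra! hin
    set o := c (α p) with ho
    set R : Finset V := (Finset.univ.filter fun a : Copy U side => a.1.1 ∉ X ∧ a ∉ S ∧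
      (swap a = a ∨ swap a ∈ S) ∧ c a = o).image fun a => a.1.1 with hR
    have hRc : R.card ≤ 1 := by
      refine Finset.card_image_le.trans (Finset.card_le_one.2 fun a ha b hb => ?_)
      have ha := (Finset.mem_filter.1 ha).2
      have hb := (Finset.mem_filter.1 hb).2
      exact hX2 a b ha.1 hb.1 ha.2.1 hb.2.1 ha.2.2.1 hb.2.2.1 (ha.2.2.2.trans hb.2.2.2.symm)
    have hXR := Finset.card_union_le X R
    have hconn := hG.2 (X ∪ R) (by omega)
    set I : Set V := {v | ∃ a : Copy U side, a.1.1 = v ∧ a ∉ S ∧ swap a ≠ a ∧ swap a ∉ S ∧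
      c a = o} with hI
    have hstep : ∀ v w, w ∉ X → w ∉ R → G.Adj v w → v ∈ I → w ∈ I := by
      rintro _ w hwX hwR hadj ⟨a, rfl, haS, hne, hsS, hca⟩
      have hcs : c (swap a) = o := by
        rw [← hc a (swap a) haS hsS (doubleGraph_adj_swap hne), hca]
      obtain ⟨a', ha'1, ha'S, ha'2, hca'⟩ : ∃ a' : Copy U side, a'.1.1 = a.1.1 ∧ a' ∉ S ∧
          a'.1.2 = (α w).1.2 ∧ c a' = o := by
        by_cases h : a.1.2 = (α w).1.2
        · exact ⟨a, rfl, haS, h, hca⟩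
        · refine ⟨swap a, swap_fst a, hsS, ?_, hcs⟩
          rw [swap_snd hne]
          exact Bool.not_eq.2 h
      have hcw : c (α w) = o := by
        rw [← hca', hc a' (α w) ha'S (hαS w hwX) (Or.inl ⟨ha'2, ?_⟩)]
        rw [ha'1, hα w]; exact hadj
      have hnb : ¬ (swap (α w) = α w ∨ swap (α w) ∈ S) := fun h =>
        hwR (Finset.mem_image.2 ⟨α w, Finset.mem_filter.2 ⟨Finset.mem_univ _,
          by rwa [hα w], hαS w hwX, h, hcw⟩, hα w⟩)
      push Not at hnb
      exact ⟨α w, hα w, hαS w hwX, hnb.1, hnb.2, hcw⟩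
    have hpI : p ∈ I := ⟨α p, hα p, hαS p hp, hin.1, hin.2, rfl⟩
    have hpR : p ∉ R := by
      intro h
      obtain ⟨a, ha, hap⟩ := Finset.mem_image.1 h
      have ha := (Finset.mem_filter.1 ha).2
      rcases eq_or_eq_swap (hap.trans (hα p).symm) with rfl | ⟨rfl, -⟩
      · exact ha.2.2.1.elim hin.1 hin.2
      · rw [swap_involutive] at ha
        exact ha.2.2.1.elim (fun h => hin.1 h.symm) (hαS p hp)
    obtain ⟨q, hqU, hq⟩ := Set.exists_mem_notMem_of_ncard_lt_ncard
      (s := ((X ∪ R : Finset V) : Set V)) (t := U) (by rw [Set.ncard_coe_finset]; omega)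
    have hpXR : p ∈ ((X ∪ R : Finset V) : Set V)ᶜ := by simp [hp, hpR]
    have hreach := (SimpleGraph.reachable_iff_reflTransGen _ _).1
      (hconn.preconnected ⟨p, hpXR⟩ ⟨q, hq⟩)
    have hqI : ∀ y, Relation.ReflTransGen (G.induce ((X ∪ R : Finset V) : Set V)ᶜ).Adj
        ⟨p, hpXR⟩ y → y.1 ∈ I := by
      intro y hy
      induction hy with
      | refl => exact hpI
      | @tail b c _ h ih =>
        have hc' := c.2
        simp only [Set.mem_compl_iff, Finset.mem_coe, Finset.mem_union, not_or] at hc'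
        exact hstep _ _ hc'.1 hc'.2 h ih
    obtain ⟨a, haq, -, hne, -⟩ := hqI _ hreach
    exact hne (swap_eq_self_iff.2 (haq ▸ hqU))
  -- Adjacent vertices with the same index have adjacent copies, hence equal labels, but a label has
  -- at most one lone copy.
  let col : (G.induce ((X : Set V)ᶜ)).Coloring Bool :=
    SimpleGraph.Coloring.mk (fun v => (α v.1).1.2) fun {v w} hadj heq => by
      have hv : v.1 ∉ X := v.2
      have hw : w.1 ∉ X := w.2
      have hadj : G.Adj v.1 w.1 := hadj
      have := hX2 (α v) (α w) (by rwa [hα v]) (by rwa [hα w]) (hαS v hv) (hαS w hw)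
        (hlone v hv) (hlone w hw) (hc _ _ (hαS v hv) (hαS w hw)
          (Or.inl ⟨heq, by rwa [hα v, hα w]⟩))
      rw [← hα v, ← hα w, this] at hadj
      exact hadj.ne rfl
  simpa using col.colorable

end Deletion

/-! ### From a large matching to disjoint odd cycles. -/

section Packing

variable {V : Type u} {G : SimpleGraph V} {U : Set V} {side : V → Bool}

theorem card_filter_eq_of_flip {K : Type*} {τ : K → K} (hτ : Function.Involutive τ) {s : Finset K}
    {ξ : K → Bool} (hs : ∀ a ∈ s, τ a ∈ s) (hξ : ∀ a ∈ s, ξ (τ a) = !ξ a) :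
    (s.filter fun a => ξ a = true).card = (s.filter fun a => ξ a = false).card := by
  refine Finset.card_bij' (fun a _ => τ a) (fun a _ => τ a) ?_ ?_ (fun a _ => hτ a) fun a _ => hτ a
  all_goals
    intro a ha
    rw [Finset.mem_filter] at ha ⊢
    exact ⟨hs a ha.1, by rw [hξ a ha.1, ha.2]; rfl⟩

open Classical in
/-- A component of the two involutions with two copies of vertices in `U`, closed up by a connected
subgraph of the bipartite graph, is not bipartite. -/
theorem not_isBipartite_of_component [Fintype V] {μ : Copy U side → Copy U side}
    (hμ : Function.Involutive μ) (hadj : ∀ a, μ a = a ∨ (doubleGraph G U side).Adj a (μ a))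
    {s : Finset (Copy U side)} (hsμ : ∀ a ∈ s, μ a ∈ s) (hsσ : ∀ a ∈ s, swap a ∈ s)
    (hfix : ∀ a ∈ s, μ a ≠ a) {a b : Copy U side} (hab : a ≠ b)
    (hs : (s.filter fun a => swap a = a) = {a, b}) {C Y : Set V}
    (hC : ReachIn (cutGraph G side) C a.1.1 b.1.1) (hCY : C ⊆ Y) (hsY : ∀ a ∈ s, a.1.1 ∈ Y) :
    ¬ (G.induce Y).IsBipartite := by
  rintro ⟨f⟩
  set χ : V → Bool := fun v => if h : v ∈ Y then decide (f ⟨v, h⟩ = 0) else false with hχ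
  have hχadj : ∀ u v, u ∈ Y → v ∈ Y → G.Adj u v → χ v = !χ u := by
    intro u v hu hv huv
    have hne : f ⟨u, hu⟩ ≠ f ⟨v, hv⟩ := f.valid (show (G.induce Y).Adj ⟨u, hu⟩ ⟨v, hv⟩ from huv)
    simp only [hχ, hu, hv, dif_pos]
    generalize f ⟨u, hu⟩ = i at hne
    generalize f ⟨v, hv⟩ = j at hne
    revert hne
    revert i j
    decide
  -- Every edge of the double graph inside s changes exactly one of colour and copy index, so `ξ` is
  -- a proper colouring there.
  set ξ : Copy U side → Bool := fun a => xor (χ a.1.1) a.1.2 with hξ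
  have hξadj : ∀ a ∈ s, ∀ b ∈ s, (doubleGraph G U side).Adj a b → ξ b = !ξ a := by
    rintro a ha b hb (⟨h1, h2⟩ | ⟨h1, h2⟩)
    · simp only [hξ, hχadj _ _ (hsY a ha) (hsY b hb) h2, h1]
      cases χ a.1.1 <;> cases b.1.2 <;> rfl
    · simp only [hξ, h1]
      exact (by decide : ∀ x s t : Bool, s ≠ t → xor x t = !xor x s) _ _ _ h2
  -- Along C colour and side change together, and on U the copy index is the side.
  have hends : ξ a = ξ b := by
    have ha : a ∈ s.filter fun a => swap a = a := by simp [hs]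
    have hb : b ∈ s.filter fun a => swap a = a := by simp [hs]
    have ha' := a.2 (swap_eq_self_iff.1 (Finset.mem_filter.1 ha).2)
    have hb' := b.2 (swap_eq_self_iff.1 (Finset.mem_filter.1 hb).2)
    have key := (hC.closed (T := {v | xor (χ v) (side v) = xor (χ a.1.1) (side a.1.1)})
      (fun u v huv hu hv hT => ?_) rfl).1
    · simp only [hξ, ha', hb']
      exact key.symm
    · have hT : xor (χ u) (side u) = _ := hT
      have h1 := hχadj u v (hCY hu) (hCY hv) huv.1
      have h2 := huv.2
      change xor (χ v) (side v) = _
      rw [← hT, h1]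
      exact (by decide : ∀ x s t : Bool, s ≠ t → xor (!x) t = xor x s) _ _ _ h2
  -- `μ` splits s evenly between the classes of `ξ`, and `swap` does the same for s without a and b.
  -- Hence a and b would get different values, against `hends`.
  have e1 := card_filter_eq_of_flip (ξ := ξ) hμ hsμ fun a ha =>
    hξadj a ha _ (hsμ a ha) ((hadj a).resolve_left (hfix a ha))
  have e2 := card_filter_eq_of_flip (ξ := ξ) (s := s.filter fun a => ¬ swap a = a)
    (swap_involutive (U := U) (side := side))
    (fun a ha => by
      rw [Finset.mem_filter] at ha ⊢
      exact ⟨hsσ a ha.1, fun h => ha.2 (swap_involutive.injective h)⟩)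
    fun a ha => by
      rw [Finset.mem_filter] at ha
      exact hξadj a ha.1 _ (hsσ a ha.1) (doubleGraph_adj_swap ha.2)
  have e3 : ∀ t : Bool, (s.filter fun a => ξ a = t).card =
      (({a, b} : Finset (Copy U side)).filter fun a => ξ a = t).card +
      ((s.filter fun a => ¬ swap a = a).filter fun a => ξ a = t).card := by
    intro t
    rw [← hs, ← Finset.card_filter_add_card_filter_not (s := s.filter fun a => ξ a = t)
      (fun a => swap a = a)]
    simp only [Finset.filter_filter, and_comm]
  rw [e3, e3, e2] at e1
  cases h : ξ b <;>
    simp [Finset.filter_insert, Finset.filter_singleton, hends, h, Finset.card_pair hab] at e1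

theorem hasDisjointOddCycles_of_involution [Fintype V] {k : ℕ}
    (hL : IsLinkedSet k (cutGraph G side) U) {μ : Copy U side → Copy U side}
    (hμ : Function.Involutive μ) (hadj : ∀ a, μ a = a ∨ (doubleGraph G U side).Adj a (μ a))
    (hfix : {a | μ a = a}.ncard + 2 * k ≤ U.ncard) : HasDisjointOddCycles G k := by
  classical
  rw [Set.ncard_eq_toFinset_card', Set.toFinset_ofPred,
    ← card_fixed_swap (U := U) (side := side)] at hfix
  obtain ⟨s, a, b, hdisj, hs⟩ := exists_disjoint_parts (k := k) hμ
    (swap_involutive (U := U) (side := side)) (by convert hfix)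
  have hfix : ∀ i c, c ∈ s i → c.1.1 ∈ U → c = a i ∨ c = b i := fun i c hc hU =>
    ((hs i).2.2.2.2 c).1 ⟨hc, swap_eq_self_iff.2 hU⟩
  have hfst : ∀ i c c', c ∈ s i → c'.1.1 = c.1.1 → c' ∈ s i := by
    intro i c c' hc h
    rcases eq_or_eq_swap h with rfl | ⟨rfl, -⟩
    · exact hc
    · exact (hs i).2.1 c hc
  let y : Fin k × Bool → Copy U side := fun p => bif p.2 then b p.1 else a p.1
  have hy : ∀ p, y p ∈ s p.1 ∧ swap (y p) = y p := by
    rintro ⟨i, _ | _⟩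
    · exact ((hs i).2.2.2.2 _).2 (Or.inl rfl)
    · exact ((hs i).2.2.2.2 _).2 (Or.inr rfl)
  have hyinj : Function.Injective fun p => (y p).1.1 := by
    rintro ⟨i, t⟩ ⟨j, t'⟩ h
    obtain rfl : i = j := hdisj i j (y (i, t)) (hy (i, t)).1 (hfst j _ _ (hy (j, t')).1 h)
    have heq : y (i, t) = y (i, t') := by
      rcases eq_or_eq_swap h with h | ⟨-, h'⟩
      · exact h
      · exact absurd (hy _).2 h'
    have hne := (hs i).2.2.2.1
    cases t <;> cases t'
    · rfl
    · exact absurd heq hne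
    · exact absurd heq.symm hne
    · rfl
  obtain ⟨C, hCU, hC, hCd⟩ := hL (fun p => (y p).1.1) hyinj fun p => swap_eq_self_iff.1 (hy p).2
  -- The links stay inside U, where the part `s i` has only its two ends, and these lie in `C i`.
  have hcross : ∀ i j c, c ∈ s i → c.1.1 ∈ C j → i = j := by
    intro i j c hc hv
    have hci : c.1.1 ∈ C i := by
      rcases hfix i c hc (hCU j hv) with rfl | rfl
      · exact (hC i).1
      · exact (hC i).2.mem (hC i).1
    exact hCd i j _ hci hv
  have hYd : ∀ i j v, v ∈ {v | ∃ c ∈ s i, c.1.1 = v} ∪ C i → v ∈ {v | ∃ c ∈ s j, c.1.1 = v} ∪ C j →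
      i = j := by
    rintro i j v (⟨c, hc, rfl⟩ | hi) (⟨c', hc', h⟩ | hj)
    · exact hdisj i j c' (hfst i _ _ hc h) hc'
    · exact hcross i j c hc hj
    · exact (hcross j i c' hc' (h ▸ hi)).symm
    · exact hCd i j v hi hj
  have hodd : ∀ i, ¬ (G.induce ({v | ∃ c ∈ s i, c.1.1 = v} ∪ C i)).IsBipartite := fun i =>
    not_isBipartite_of_component hμ hadj (hs i).1 (hs i).2.1 (hs i).2.2.1 (hs i).2.2.2.1
      (by ext c; simpa using (hs i).2.2.2.2 c) (hC i).2 Set.subset_union_right fun c hc => Or.inl ⟨c, hc, rfl⟩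
  choose v w hw hwY using fun i => exists_odd_cycle_of_not_isBipartite (hodd i)
  exact ⟨v, w, hw, fun i j hij z hi hj => hij (hYd i j z (hwY i z hi) (hwY j z hj))⟩

end Packing

end OddCyclePacking

/-! ### The main theorem. -/

theorem mainTheorem11 {V : Type*} [Fintype V] (G : SimpleGraph V) (k : ℕ)
    (hG : OddCyclePacking.IsVertexConnected G (50 * k)) :
    OddCyclePacking.HasDisjointOddCycles G k ∨
      ∃ X : Finset V, X.card = 2 * k - 2 ∧ (G.induce ((X : Set V)ᶜ)).IsBipartite := by
  classical
  obtain rfl | hk := Nat.eq_zero_or_pos k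
  · exact Or.inl ⟨Fin.elim0, fun i => i.elim0, fun i => i.elim0, fun i => i.elim0⟩
  obtain ⟨side, U, hU, hL⟩ := hG.exists_linked_cut hk
  rcases OddCyclePacking.tutte_berge (OddCyclePacking.doubleGraph G U side) (U.ncard - 2 * k)
    (OddCyclePacking.even_card_copy (by omega)) with ⟨μ, hμ, hadj, hfix⟩ |
    ⟨S, γ, c, O, hc, hodd, hO⟩
  · exact Or.inl (OddCyclePacking.hasDisjointOddCycles_of_involution hL hμ hadj (by omega))
  · right
    have hne : U.Nonempty := Set.nonempty_of_ncard_ne_zero (by omega)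
    obtain ⟨X, hX, hX1, hX2⟩ := OddCyclePacking.exists_deletion hne hc hodd
    have hbip := OddCyclePacking.isBipartite_of_labels hG (by omega) (by omega) hc hX1 hX2
    have hV := hG.1
    -- In `hX` and `hO` the terms |S| and |U| cancel, leaving |X| ≤ 2k - 2. Enlarging X to this
    -- exact size preserves bipartiteness.
    obtain ⟨X', hXX', -, hX'⟩ := Finset.exists_subsuperset_card_eq (Finset.subset_univ X)
      (n := 2 * k - 2) (by omega) (by rw [Finset.card_univ]; omega)
    refine ⟨X', hX', ?_⟩
    exact hbip.of_hom (G.induceHomOfLE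
      (Set.compl_subset_compl.2 (Finset.coe_subset.2 hXX'))).toHom
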